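/- Let $1\le k\le n-2$, let $C_n\subset\mathbb{P}^n$ be the complex rational normal curve, the image of $\nu_n:\mathbb{P}^1\to\mathbb{P}^n$, $\nu_n(s:t)=(s^n:s^{n-1}t:\dots:t^n)$, and let $L\cong\mathbb{P}^{k-1}$ be a linear subspace of $\mathbb{P}^n$ with $L\cap C_n=\emptyset$. Let $\pi_L:\mathbb{P}^n\dashrightarrow\mathbb{P}^{n-k}$ be the projection with centre $L$, so that $f=\pi_L\circ\nu_n:\mathbb{P}^1\to\mathbb{P}^{n-k}$ is a morphism given by binary forms of degree $n$, and let $$N_{\pi_L(C_n);\mathbb{P}^{n-k}}=\operatorname{coker}\bigl(df: T_{\mathbb{P}^1}\to f^*T_{\mathbb{P}^{n-k}}\bigr),$$ that is, the cokernel of the Jacobian matrix $\mathcal{O}(1)^{2}\to\mathcal{O}(n)^{n-k+1}$ of these forms, a sheaf on $\mathbb{P}^1$. If $L$ is contained in a $(k+1)$-secant $\mathbb{P}^{k}$ of $C_n$, i.e. in the $k$-dimensional linear span of $k+1$ distinct points of $C_n$, then $$N_{\pi_L(C_n);\mathbb{P}^{n-k}}\cong\mathcal{O}_{\mathbb{P}^1}(n+2)^{n-k-2}\oplus\mathcal{O}_{\mathbb{P}^1}(n+2+2k).$$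 -/

import Mathlib

open scoped LaurentPolynomial LinearAlgebra.Projectivization Polynomial

noncomputable section

/-! ## Quasi-coherent sheaves on the projective line, in the two standard charts

The homogeneous coordinates of the projective line are `s`, `t`. The first chart is `s ≠ 0`, with
coordinate `z = t / s` and ring `ℂ[z]`; the second chart is `t ≠ 0`, with coordinate `w = s / t` and
ring `ℂ[w]`; on the overlap, with ring `ℂ[z, z⁻¹]`, one has `w = z⁻¹`. -/

namespace ProjLine

/-- Restriction of functions from the first chart to the overlap, `z ↦ z`. -/
def toOverlap₀ : ℂ[X] →+* ℂ[T;T⁻¹] := Polynomial.toLaurent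

/-- Restriction of functions from the second chart to the overlap, `w ↦ z⁻¹`. -/
def toOverlap₁ : ℂ[X] →+* ℂ[T;T⁻¹] :=
  (LaurentPolynomial.invert (R := ℂ)).toRingEquiv.toRingHom.comp Polynomial.toLaurent

/-- A quasi-coherent sheaf on the complex projective line, given by its modules of sections on
the two standard charts and on their overlap, and the restriction maps. Quasi-coherence says
that the sections on the overlap are the localization of the sections on either chart. -/
structure QCoh where
  /-- sections on the first chart -/
  M₀ : Type
  /-- sections on the second chart -/
  M₁ : Type
  /-- sections on the overlap -/
  M₀₁ : Type
  [acg₀ : AddCommGroup M₀]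
  [acg₁ : AddCommGroup M₁]
  [acg₀₁ : AddCommGroup M₀₁]
  [mod₀ : Module ℂ[X] M₀]
  [mod₁ : Module ℂ[X] M₁]
  [mod₀₁ : Module ℂ[T;T⁻¹] M₀₁]
  /-- restriction from the first chart to the overlap -/
  res₀ : M₀ →ₛₗ[toOverlap₀] M₀₁
  /-- restriction from the second chart to the overlap -/
  res₁ : M₁ →ₛₗ[toOverlap₁] M₀₁
  res₀_surj : ∀ y : M₀₁, ∃ (r : ℕ) (x : M₀),
    res₀ x = toOverlap₀ ((Polynomial.X : ℂ[X]) ^ r) • y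
  res₁_surj : ∀ y : M₀₁, ∃ (r : ℕ) (x : M₁),
    res₁ x = toOverlap₁ ((Polynomial.X : ℂ[X]) ^ r) • y
  res₀_ker : ∀ x : M₀, res₀ x = 0 → ∃ r : ℕ, (Polynomial.X : ℂ[X]) ^ r • x = 0
  res₁_ker : ∀ x : M₁, res₁ x = 0 → ∃ r : ℕ, (Polynomial.X : ℂ[X]) ^ r • x = 0

attribute [instance] QCoh.acg₀ QCoh.acg₁ QCoh.acg₀₁ QCoh.mod₀ QCoh.mod₁ QCoh.mod₀₁

/-- A morphism of sheaves: maps of sections that commute with restriction. -/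
structure QCoh.Hom (A B : QCoh) where
  f₀ : A.M₀ →ₗ[ℂ[X]] B.M₀
  f₁ : A.M₁ →ₗ[ℂ[X]] B.M₁
  f₀₁ : A.M₀₁ →ₗ[ℂ[T;T⁻¹]] B.M₀₁
  comm₀ : ∀ x, B.res₀ (f₀ x) = f₀₁ (A.res₀ x)
  comm₁ : ∀ x, B.res₁ (f₁ x) = f₀₁ (A.res₁ x)

/-- An isomorphism of sheaves. -/
structure QCoh.Iso (A B : QCoh) where
  e₀ : A.M₀ ≃ₗ[ℂ[X]] B.M₀
  e₁ : A.M₁ ≃ₗ[ℂ[X]] B.M₁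
  e₀₁ : A.M₀₁ ≃ₗ[ℂ[T;T⁻¹]] B.M₀₁
  comm₀ : ∀ x, B.res₀ (e₀ x) = e₀₁ (A.res₀ x)
  comm₁ : ∀ x, B.res₁ (e₁ x) = e₀₁ (A.res₁ x)

/-- The cokernel of a morphism of quasi-coherent sheaves, computed on each chart. -/
def QCoh.Hom.coker {A B : QCoh} (f : A.Hom B) : QCoh where
  M₀ := B.M₀ ⧸ LinearMap.range f.f₀
  M₁ := B.M₁ ⧸ LinearMap.range f.f₁
  M₀₁ := B.M₀₁ ⧸ LinearMap.range f.f₀₁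
  res₀ := Submodule.mapQ _ _ B.res₀ (by
    rintro _ ⟨a, rfl⟩
    exact ⟨A.res₀ a, (f.comm₀ a).symm⟩)
  res₁ := Submodule.mapQ _ _ B.res₁ (by
    rintro _ ⟨a, rfl⟩
    exact ⟨A.res₁ a, (f.comm₁ a).symm⟩)
  res₀_surj := by
    intro y
    obtain ⟨y, rfl⟩ := Submodule.Quotient.mk_surjective _ y
    obtain ⟨r, x, h⟩ := B.res₀_surj y
    exact ⟨r, Submodule.Quotient.mk x, by rw [Submodule.mapQ_apply, h]; rfl⟩
  res₁_surj := by
    intro y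
    obtain ⟨y, rfl⟩ := Submodule.Quotient.mk_surjective _ y
    obtain ⟨r, x, h⟩ := B.res₁_surj y
    exact ⟨r, Submodule.Quotient.mk x, by rw [Submodule.mapQ_apply, h]; rfl⟩
  res₀_ker := by
    intro x hx
    obtain ⟨b, rfl⟩ := Submodule.Quotient.mk_surjective _ x
    rw [Submodule.mapQ_apply, Submodule.Quotient.mk_eq_zero] at hx
    obtain ⟨y, hy⟩ := hx
    obtain ⟨r, a, ha⟩ := A.res₀_surj y
    have h0 : B.res₀ ((Polynomial.X : ℂ[X]) ^ r • b - f.f₀ a) = 0 := by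
      rw [map_sub, LinearMap.map_smulₛₗ, f.comm₀, ha, map_smul, hy, sub_self]
    obtain ⟨q, hq⟩ := B.res₀_ker _ h0
    refine ⟨q + r, ?_⟩
    rw [← Submodule.Quotient.mk_smul, Submodule.Quotient.mk_eq_zero]
    refine ⟨(Polynomial.X : ℂ[X]) ^ q • a, ?_⟩
    rw [smul_sub, sub_eq_zero] at hq
    rw [map_smul, ← hq, pow_add, mul_smul]
  res₁_ker := by
    intro x hx
    obtain ⟨b, rfl⟩ := Submodule.Quotient.mk_surjective _ x
    rw [Submodule.mapQ_apply, Submodule.Quotient.mk_eq_zero] at hx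
    obtain ⟨y, hy⟩ := hx
    obtain ⟨r, a, ha⟩ := A.res₁_surj y
    have h0 : B.res₁ ((Polynomial.X : ℂ[X]) ^ r • b - f.f₁ a) = 0 := by
      rw [map_sub, LinearMap.map_smulₛₗ, f.comm₁, ha, map_smul, hy, sub_self]
    obtain ⟨q, hq⟩ := B.res₁_ker _ h0
    refine ⟨q + r, ?_⟩
    rw [← Submodule.Quotient.mk_smul, Submodule.Quotient.mk_eq_zero]
    refine ⟨(Polynomial.X : ℂ[X]) ^ q • a, ?_⟩
    rw [smul_sub, sub_eq_zero] at hq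
    rw [map_smul, ← hq, pow_add, mul_smul]

lemma toOverlap₀_X_pow (r : ℕ) :
    toOverlap₀ ((Polynomial.X : ℂ[X]) ^ r) = LaurentPolynomial.T r := by
  simp [toOverlap₀]

lemma toOverlap₁_X_pow (r : ℕ) :
    toOverlap₁ ((Polynomial.X : ℂ[X]) ^ r) = LaurentPolynomial.T (-r) := by
  simp [toOverlap₁]

lemma toOverlap₀_injective : Function.Injective toOverlap₀ :=
  Polynomial.toLaurent_injective

lemma toOverlap₁_injective : Function.Injective toOverlap₁ :=
  (LaurentPolynomial.invert (R := ℂ)).injective.comp Polynomial.toLaurent_injective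

lemma exists_toOverlap₀ (p : ℂ[T;T⁻¹]) :
    ∃ r : ℕ, ∀ q : ℕ, r ≤ q → ∃ x : ℂ[X], toOverlap₀ x = LaurentPolynomial.T q * p := by
  obtain ⟨r, x, hx⟩ := p.exists_T_pow
  refine ⟨r, fun q hq => ⟨Polynomial.X ^ (q - r) * x, ?_⟩⟩
  rw [map_mul, toOverlap₀_X_pow, toOverlap₀, hx, LaurentPolynomial.T_mul, mul_assoc,
    ← LaurentPolynomial.T_add, LaurentPolynomial.T_mul]
  congr 2
  omega

lemma exists_toOverlap₁ (p : ℂ[T;T⁻¹]) :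
    ∃ r : ℕ, ∀ q : ℕ, r ≤ q → ∃ x : ℂ[X], toOverlap₁ x = LaurentPolynomial.T (-q) * p := by
  obtain ⟨r, h⟩ := exists_toOverlap₀ (LaurentPolynomial.invert p)
  refine ⟨r, fun q hq => ?_⟩
  obtain ⟨x, hx⟩ := h q hq
  refine ⟨x, ?_⟩
  have : toOverlap₁ x = LaurentPolynomial.invert (toOverlap₀ x) := rfl
  rw [this, hx, map_mul, LaurentPolynomial.invert_T]
  congr 1
  exact LaurentPolynomial.involutive_invert p

/-- The vector bundle `⨁ᵢ 𝒪(aᵢ)`. A section of `𝒪(a)` is a polynomial `p(z)` on the first chart and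
a polynomial `q(w)` on the second chart, glued by `p(z) = zᵃ q(z⁻¹)`. -/
def sumO {ι : Type} [Fintype ι] (a : ι → ℤ) : QCoh where
  M₀ := ι → ℂ[X]
  M₁ := ι → ℂ[X]
  M₀₁ := ι → ℂ[T;T⁻¹]
  res₀ :=
    { toFun := fun x i => toOverlap₀ (x i)
      map_add' := fun x y => by ext1 i; simp
      map_smul' := fun c x => by ext1 i; simp }
  res₁ :=
    { toFun := fun x i => LaurentPolynomial.T (a i) * toOverlap₁ (x i)
      map_add' := fun x y => by ext1 i; simp [mul_add]
      map_smul' := fun c x => by ext1 i; simp only [Pi.smul_apply, smul_eq_mul, map_mul]; ring }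
  res₀_surj := by
    intro y
    choose r hr using fun i => exists_toOverlap₀ (y i)
    choose x hx using fun i => hr i (Finset.univ.sup r) (Finset.le_sup (Finset.mem_univ i))
    refine ⟨Finset.univ.sup r, x, ?_⟩
    ext1 i
    rw [toOverlap₀_X_pow]
    exact hx i
  res₁_surj := by
    intro y
    choose r hr using fun i => exists_toOverlap₁ (LaurentPolynomial.T (-a i) * y i)
    choose x hx using fun i => hr i (Finset.univ.sup r) (Finset.le_sup (Finset.mem_univ i))
    refine ⟨Finset.univ.sup r, x, ?_⟩
    ext1 i
    rw [toOverlap₁_X_pow]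
    change LaurentPolynomial.T (a i) * toOverlap₁ (x i) = LaurentPolynomial.T _ * y i
    rw [hx i, ← mul_assoc, ← mul_assoc, ← LaurentPolynomial.T_add, ← LaurentPolynomial.T_add]
    congr 2
    ring
  res₀_ker := by
    intro x hx
    refine ⟨0, ?_⟩
    ext1 i
    have h : toOverlap₀ (x i) = 0 := congrFun hx i
    have h' : x i = 0 := (map_eq_zero_iff _ toOverlap₀_injective).1 h
    simp [h']
  res₁_ker := by
    intro x hx
    refine ⟨0, ?_⟩
    ext1 i
    have h : LaurentPolynomial.T (a i) * toOverlap₁ (x i) = 0 := congrFun hx i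
    have h1 : toOverlap₁ (x i) = 0 := by
      have := congrArg (fun p => LaurentPolynomial.T (-a i) * p) h
      simpa [← mul_assoc, ← LaurentPolynomial.T_add] using this
    have h' : x i = 0 := (map_eq_zero_iff _ toOverlap₁_injective).1 h1
    simp [h']

/-- `P` is a binary form of degree `d` in `s = X 0`, `t = X 1`; the zero form has every degree, and
it is the only form of negative degree. -/
def IsForm (P : MvPolynomial (Fin 2) ℂ) (d : ℤ) : Prop :=
  P = 0 ∨ ∃ r : ℕ, (r : ℤ) = d ∧ P.IsHomogeneous r

/-- A binary form in the coordinate of the first chart, `P(1, z)`. -/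
def dehom₀ : MvPolynomial (Fin 2) ℂ →ₐ[ℂ] ℂ[X] := MvPolynomial.aeval ![1, Polynomial.X]

/-- A binary form in the coordinate of the second chart, `P(w, 1)`. -/
def dehom₁ : MvPolynomial (Fin 2) ℂ →ₐ[ℂ] ℂ[X] := MvPolynomial.aeval ![Polynomial.X, 1]

lemma dehom_glue {P : MvPolynomial (Fin 2) ℂ} {d : ℤ} (h : IsForm P d) :
    toOverlap₀ (dehom₀ P) = LaurentPolynomial.T d * toOverlap₁ (dehom₁ P) := by
  rcases h with rfl | ⟨r, rfl, h⟩
  · simp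
  · conv_lhs => rw [P.as_sum]
    conv_rhs => rw [P.as_sum]
    simp only [map_sum, Finset.mul_sum]
    refine Finset.sum_congr rfl fun m hm => ?_
    have hdeg : m 0 + m 1 = r := by
      have := h.degree_eq_sum_deg_support hm
      rw [this, ← Finsupp.degree_apply, Finsupp.degree_eq_sum, Fin.sum_univ_two]
    simp only [dehom₀, dehom₁, MvPolynomial.aeval_monomial]
    simp only [Finsupp.prod_fintype, pow_zero, implies_true, Fin.prod_univ_two,
      Matrix.cons_val_zero, Matrix.cons_val_one, one_pow, one_mul, mul_one, map_mul,
      toOverlap₀_X_pow, toOverlap₁_X_pow]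
    have hc : toOverlap₁ (algebraMap ℂ ℂ[X] (MvPolynomial.coeff m P))
        = toOverlap₀ (algebraMap ℂ ℂ[X] (MvPolynomial.coeff m P)) := by
      simp [toOverlap₀, toOverlap₁]
    rw [hc, mul_left_comm, ← LaurentPolynomial.T_add, ← hdeg]
    congr 2
    push_cast
    ring

/-- The morphism `⨁ᵢ 𝒪(aᵢ) ⟶ ⨁ⱼ 𝒪(bⱼ)` given by a matrix of binary forms of degrees `bⱼ - aᵢ`. -/
def formHom {ι κ : Type} [Fintype ι] [Fintype κ] {a : ι → ℤ} {b : κ → ℤ}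
    (A : Matrix κ ι (MvPolynomial (Fin 2) ℂ)) (hA : ∀ j i, IsForm (A j i) (b j - a i)) :
    (sumO a).Hom (sumO b) where
  f₀ := (A.map dehom₀).mulVecLin
  f₁ := (A.map dehom₁).mulVecLin
  f₀₁ := (A.map fun P => toOverlap₀ (dehom₀ P)).mulVecLin
  comm₀ := by
    intro x
    funext j
    change toOverlap₀ (∑ i, dehom₀ (A j i) * x i)
      = ∑ i, toOverlap₀ (dehom₀ (A j i)) * toOverlap₀ (x i)
    simp
  comm₁ := by
    intro x
    funext j
    change LaurentPolynomial.T (b j) * toOverlap₁ (∑ i, dehom₁ (A j i) * x i)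
      = ∑ i, toOverlap₀ (dehom₀ (A j i)) * (LaurentPolynomial.T (a i) * toOverlap₁ (x i))
    rw [map_sum, Finset.mul_sum]
    refine Finset.sum_congr rfl fun i _ => ?_
    have hT : (LaurentPolynomial.T (b j) : ℂ[T;T⁻¹])
        = LaurentPolynomial.T (b j - a i) * LaurentPolynomial.T (a i) := by
      rw [← LaurentPolynomial.T_add, sub_add_cancel]
    rw [dehom_glue (hA j i), map_mul, hT]
    ring

/-! ## The normal bundle of a parametrized rational curve -/

/-- The Jacobian matrix of a tuple `F` of binary forms. -/
def jacobian {m : ℕ} (F : Fin (m + 1) → MvPolynomial (Fin 2) ℂ) :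
    Matrix (Fin (m + 1)) (Fin 2) (MvPolynomial (Fin 2) ℂ) :=
  fun j i => MvPolynomial.pderiv i (F j)

lemma jacobian_isForm {m n : ℕ} {F : Fin (m + 1) → MvPolynomial (Fin 2) ℂ}
    (hF : ∀ j, (F j).IsHomogeneous n) (j : Fin (m + 1)) (i : Fin 2) :
    IsForm (jacobian F j i) ((fun _ : Fin (m + 1) => (n : ℤ)) j - (fun _ : Fin 2 => (1 : ℤ)) i) := by
  rcases Nat.eq_zero_or_pos n with rfl | hn
  · left
    have h := (MvPolynomial.totalDegree_zero_iff_isHomogeneous _).2 (hF j)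
    rw [MvPolynomial.totalDegree_eq_zero_iff_eq_C] at h
    rw [jacobian, h, MvPolynomial.pderiv_C]
  · right
    exact ⟨n - 1, by push_cast [Nat.cast_sub hn]; rfl, (hF j).pderiv⟩

/-- The normal sheaf `N_f = f^* T_{ℙᵐ} / T_{ℙ¹}` of the morphism `f : ℙ¹ ⟶ ℙᵐ` given by `m + 1` binary
forms of degree `n`. By the Euler sequences, `T_{ℙ¹}` and `f^* T_{ℙᵐ}` are the quotients of `𝒪(1)²` and
of `𝒪(n)^{m+1}` by copies of `𝒪`, the differential of `f` is induced by the Jacobian matrix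
`𝒪(1)² ⟶ 𝒪(n)^{m+1}` of the forms, and `N_f` is the cokernel of the latter. -/
def normalSheaf {m n : ℕ} (F : Fin (m + 1) → MvPolynomial (Fin 2) ℂ)
    (hF : ∀ j, (F j).IsHomogeneous n) : QCoh :=
  (formHom (a := fun _ : Fin 2 => (1 : ℤ)) (b := fun _ : Fin (m + 1) => (n : ℤ))
    (jacobian F) (jacobian_isForm hF)).coker

end ProjLine

/-! ## The rational normal curve, its secant spaces and its projections -/

/-- The Veronese vector `(sⁿ, sⁿ⁻¹ t, …, tⁿ)`, where `x = (s, t)`. -/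
def veronese (n : ℕ) (x : Fin 2 → ℂ) : Fin (n + 1) → ℂ :=
  fun i => x 0 ^ (n - (i : ℕ)) * x 1 ^ (i : ℕ)

/-- The rational normal curve `C_n` in `ℙⁿ`. -/
def rationalNormalCurve (n : ℕ) : Set (ℙ ℂ (Fin (n + 1) → ℂ)) :=
  {p | ∃ x : Fin 2 → ℂ, x ≠ 0 ∧ p.submodule = Submodule.span ℂ {veronese n x}}

/-- The linear subspace of `ℙⁿ` with underlying vector space `M` is an `r`-secant `ℙ^{r-1}` of `C_n`: it
has projective dimension `r - 1` and is spanned by `r` distinct points of `C_n`. -/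
def IsSecantSpace (n r : ℕ) (M : Submodule ℂ (Fin (n + 1) → ℂ)) : Prop :=
  Module.finrank ℂ M = r ∧ ∃ S : Finset (ℙ ℂ (Fin (n + 1) → ℂ)),
    (S : Set (ℙ ℂ (Fin (n + 1) → ℂ))) ⊆ rationalNormalCurve n ∧ S.card = r ∧
    M = ⨆ p ∈ S, p.submodule

/-- The binary forms of degree `n` that parametrize the image of `C_n` under the linear projection
`ℙⁿ ⇢ ℙᵐ` induced by `π`, that is, the coordinates of `π (sⁿ, sⁿ⁻¹ t, …, tⁿ)`. -/
def projectedCurve {n m : ℕ} (π : (Fin (n + 1) → ℂ) →ₗ[ℂ] (Fin (m + 1) → ℂ)) :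
    Fin (m + 1) → MvPolynomial (Fin 2) ℂ :=
  fun j => ∑ i : Fin (n + 1), MvPolynomial.C (π (Pi.single i 1) j) *
    (MvPolynomial.X 0 ^ (n - (i : ℕ)) * MvPolynomial.X 1 ^ (i : ℕ))

lemma projectedCurve_isHomogeneous {n m : ℕ}
    (π : (Fin (n + 1) → ℂ) →ₗ[ℂ] (Fin (m + 1) → ℂ)) (j : Fin (m + 1)) :
    (projectedCurve π j).IsHomogeneous n := by
  refine MvPolynomial.IsHomogeneous.sum _ _ _ fun i _ => ?_
  have h := (MvPolynomial.isHomogeneous_C (Fin 2) (π (Pi.single i 1) j)).mul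
    ((MvPolynomial.isHomogeneous_X_pow (R := ℂ) (0 : Fin 2) (n - (i : ℕ))).mul
      (MvPolynomial.isHomogeneous_X_pow (R := ℂ) (1 : Fin 2) (i : ℕ)))
  have e : 0 + (n - (i : ℕ) + (i : ℕ)) = n := by omega
  rwa [e] at h

end

/-! Write n = k + e + 2. Let g be the form of degree k + 1 vanishing at the secant points. The
functionals killing the secant space M correspond to the forms g * m with m of degree e + 1. Since L
is a hyperplane in M, the linear system of the projection is these multiples together with one
further form h. As L misses the curve, h vanishes at no secant point (`exists_forms_of_secant`). So,
up to an invertible constant matrix, the curve is given by the g * mᵢ, with mᵢ = s^(e+1-i) t^i, and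
h.

By Euler's formula mᵢ is a combination of its own partial derivatives, so the gradient of g * mᵢ is
the gradient of mᵢ times a 2 × 2 matrix independent of i (`multipleJacobian_mulVec`). The Jacobian
matrix thus factors through the monomial gradients together with h, leaving a 3 × 2 matrix. The
monomial gradients satisfy e quadratic syzygies, the second differences, which present their
cokernel. The 3 × 2 matrix has, up to a scalar, the maximal minors tW - (e+1) g hₛ, -sW - (e+1) g hₜ
and n g², where W is the Wronskian of g and h. At a common zero g = 0, hence W = 0; but g has simple
zeros and h does not vanish there, so W ≠ 0 (`eval_wronskian_ne_zero`). Without common zeros, the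
minors present the cokernel of the 3 × 2 matrix as a line bundle (`syzygyMatrix_exact`).

The minors only define a functional on the span of the gradients. It extends to a row of forms of
degree 2k + 2 by `exists_vecMul_monomialJacobian`. Hence the syzygy matrix has e rows of degree 2
and one row of degree 2k + 2, and its target is the asserted bundle. -/

noncomputable section

namespace ProjLine

/-! ### Cokernels from exactness on the two charts -/

/-- A complex of sheaves `A ⟶ B ⟶ C ⟶ 0` that is exact on both charts presents `C` as the cokernel of
`A ⟶ B`. -/
lemma QCoh.Hom.nonempty_coker_iso {A B C : QCoh} (f : A.Hom B) (g : B.Hom C)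
    (h₀ : Function.Exact f.f₀ g.f₀) (h₁ : Function.Exact f.f₁ g.f₁)
    (s₀ : Function.Surjective g.f₀) (s₁ : Function.Surjective g.f₁) :
    Nonempty (f.coker.Iso C) := by
  have hT : ∀ (M : Type) [AddCommGroup M] [Module ℂ[T;T⁻¹] M] (r : ℕ) (y : M),
      (LaurentPolynomial.T (-(r : ℤ)) : ℂ[T;T⁻¹]) • (LaurentPolynomial.T (r : ℤ) : ℂ[T;T⁻¹]) • y = y := by
    intro M _ _ r y
    rw [smul_smul, ← LaurentPolynomial.T_add]
    simp
  -- On the overlap, surjectivity and exactness follow from the first chart: sections extend after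
  -- multiplication by a power of z, and that power is invertible on the overlap.
  have s₀₁ : Function.Surjective g.f₀₁ := by
    intro y
    obtain ⟨r, x, hx⟩ := C.res₀_surj y
    obtain ⟨b, rfl⟩ := s₀ x
    refine ⟨(LaurentPolynomial.T (-(r : ℤ)) : ℂ[T;T⁻¹]) • B.res₀ b, ?_⟩
    rw [map_smul, ← g.comm₀, hx, toOverlap₀_X_pow, hT]
  have h₀₁ : Function.Exact f.f₀₁ g.f₀₁ := by
    intro y
    constructor
    · intro hy
      obtain ⟨r, b, hb⟩ := B.res₀_surj y
      have h : C.res₀ (g.f₀ b) = 0 := by rw [g.comm₀, hb, map_smul, hy, smul_zero]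
      obtain ⟨q, hq⟩ := C.res₀_ker _ h
      rw [← map_smul] at hq
      obtain ⟨a, ha⟩ := (h₀ _).1 hq
      refine ⟨(LaurentPolynomial.T (-(r : ℤ)) : ℂ[T;T⁻¹]) •
        (LaurentPolynomial.T (-(q : ℤ)) : ℂ[T;T⁻¹]) • A.res₀ a, ?_⟩
      rw [map_smul, map_smul, ← f.comm₀, ha, LinearMap.map_smulₛₗ, hb, toOverlap₀_X_pow,
        toOverlap₀_X_pow, hT, hT]
    · rintro ⟨a, rfl⟩
      obtain ⟨r, x, hx⟩ := A.res₀_surj a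
      have h : g.f₀₁ (f.f₀₁ (A.res₀ x)) = 0 := by
        rw [← f.comm₀, ← g.comm₀, (h₀ _).2 ⟨x, rfl⟩, map_zero]
      rw [hx, toOverlap₀_X_pow, map_smul, map_smul] at h
      rw [← hT _ r (g.f₀₁ (f.f₀₁ a)), h, smul_zero]
  exact ⟨{
    e₀ := (Submodule.quotEquivOfEq _ _ (LinearMap.exact_iff.1 h₀).symm).trans
      (g.f₀.quotKerEquivOfSurjective s₀)
    e₁ := (Submodule.quotEquivOfEq _ _ (LinearMap.exact_iff.1 h₁).symm).trans
      (g.f₁.quotKerEquivOfSurjective s₁)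
    e₀₁ := (Submodule.quotEquivOfEq _ _ (LinearMap.exact_iff.1 h₀₁).symm).trans
      (g.f₀₁.quotKerEquivOfSurjective s₀₁)
    comm₀ := by
      intro x
      obtain ⟨x, rfl⟩ := Submodule.Quotient.mk_surjective _ x
      exact g.comm₀ x
    comm₁ := by
      intro x
      obtain ⟨x, rfl⟩ := Submodule.Quotient.mk_surjective _ x
      exact g.comm₁ x }⟩

/-! ### Gradients of monomials and their second differences -/

section Matrices

variable {R : Type*} [CommRing R]

/-- The gradients of the monomials `s ^ (e + 1 - i) * t ^ i`. -/
def monomialJacobian (s t : R) (e : ℕ) : Matrix (Fin (e + 2)) (Fin 2) R :=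
  Matrix.of fun i => ![((e + 1 - i : ℕ) : R) * (s ^ (e - i : ℕ) * t ^ (i : ℕ)),
    ((i : ℕ) : R) * (s ^ (e + 1 - i : ℕ) * t ^ (i - 1 : ℕ))]

/-- The linear syzygies `t² aᵢ - 2 s t aᵢ₊₁ + s² aᵢ₊₂` of the gradients of the monomials. -/
def secondDifference (s t : R) (e : ℕ) : Matrix (Fin e) (Fin (e + 2)) R :=
  Matrix.of fun i => Pi.single i.castSucc.castSucc (t ^ 2) +
    Pi.single i.castSucc.succ (-(2 * s * t)) + Pi.single i.succ.succ (s ^ 2)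

lemma secondDifference_mulVec (s t : R) (e : ℕ) (a : Fin (e + 2) → R) (i : Fin e) :
    (secondDifference s t e).mulVec a i =
      t ^ 2 * a i.castSucc.castSucc - 2 * s * t * a i.castSucc.succ + s ^ 2 * a i.succ.succ := by
  simp only [secondDifference, Matrix.mulVec, Matrix.of_apply, add_dotProduct, single_dotProduct]
  ring

lemma monomialJacobian_mulVec (s t : R) (e : ℕ) (x : Fin 2 → R) (i : Fin (e + 2)) :
    (monomialJacobian s t e).mulVec x i =
      ((e + 1 - i : ℕ) : R) * (s ^ (e - i : ℕ) * t ^ (i : ℕ)) * x 0 +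
      ((i : ℕ) : R) * (s ^ (e + 1 - i : ℕ) * t ^ (i - 1 : ℕ)) * x 1 := by
  simp [monomialJacobian, Matrix.mulVec, dotProduct, Fin.sum_univ_two]

lemma monomialJacobian_map {S : Type*} [CommRing S] (φ : R →+* S) (s t : R) (e : ℕ) :
    (monomialJacobian s t e).map φ = monomialJacobian (φ s) (φ t) e := by
  ext i j
  fin_cases j <;> simp [monomialJacobian]

lemma secondDifference_map {S : Type*} [CommRing S] (φ : R →+* S) (s t : R) (e : ℕ) :
    (secondDifference s t e).map φ = secondDifference (φ s) (φ t) e := by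
  ext i j
  simp [secondDifference, Pi.single_apply, apply_ite φ, map_ofNat]

/-- The monomial `s ^ (e + 1 - i) * t ^ i` in terms of its gradient. -/
lemma monomialJacobian_euler (s t : R) (e : ℕ) (i : Fin (e + 2)) :
    s * monomialJacobian s t e i 0 + t * monomialJacobian s t e i 1 =
      ((e + 1 : ℕ) : R) * (s ^ (e + 1 - i : ℕ) * t ^ (i : ℕ)) := by
  obtain ⟨i, hi⟩ := i
  simp only [monomialJacobian, Matrix.of_apply, Matrix.cons_val_zero, Matrix.cons_val_one]
  rcases Nat.lt_or_ge e i with h | h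
  · obtain rfl : i = e + 1 := by omega
    simp [pow_succ]; ring
  · obtain ⟨j, rfl⟩ := Nat.exists_eq_add_of_le h
    have h1 : i + j + 1 - i = j + 1 := by omega
    have h2 : i + j - i = j := by omega
    rw [h1, h2]
    cases i with
    | zero => simp; ring
    | succ i => simp; ring

/-- For s = 1 the i-th gradient is t^i times a polynomial in i of degree at most one (t being
invertible), so it satisfies the recurrence with characteristic polynomial (X - t)²; the syzygy is
its homogenization. -/
lemma secondDifference_comp (s t : R) (e : ℕ) (x : Fin 2 → R) :
    (secondDifference s t e).mulVec ((monomialJacobian s t e).mulVec x) = 0 := by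
  ext ⟨i, hi⟩
  rw [secondDifference_mulVec]
  simp only [monomialJacobian_mulVec, Fin.val_castSucc, Fin.val_succ, Pi.zero_apply]
  obtain ⟨j, rfl⟩ := Nat.exists_eq_add_of_lt hi
  have h1 : i + j + 1 + 1 - i = j + 2 := by omega
  have h2 : i + j + 1 - i = j + 1 := by omega
  have h3 : i + j + 1 + 1 - (i + 1) = j + 1 := by omega
  have h4 : i + j + 1 - (i + 1) = j := by omega
  have h5 : i + j + 1 + 1 - (i + 1 + 1) = j := by omega
  have h6 : i + j + 1 - (i + 1 + 1) = j - 1 := by omega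
  rw [h1, h2, h3, h4, h5, h6]
  -- The truncated exponents i - 1 and j - 1 at zero occur only with coefficient zero.
  rcases i with _ | i <;> rcases j with _ | j <;> simp <;> ring

/-- With s = 1 the coefficient of aᵢ₊₂ is 1, so the inhomogeneous recurrence can be solved step by
step from the initial values 0, 0. -/
lemma secondDifference_surjective_of_left (t : R) (e : ℕ) :
    Function.Surjective (secondDifference 1 t e).mulVec := by
  intro b
  let c : ℕ → R := fun i => if h : i < e then b ⟨i, h⟩ else 0
  let p : ℕ → R × R := fun i =>
    Nat.rec (0, 0) (fun i p => (p.2, c i + 2 * t * p.2 - t ^ 2 * p.1)) i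
  refine ⟨fun i => (p i).1, ?_⟩
  ext i
  rw [secondDifference_mulVec]
  have hc : c i = b i := by simp [c]
  rw [← hc]
  simp only [Fin.val_castSucc, Fin.val_succ]
  change t ^ 2 * (p i).1 - 2 * 1 * t * (p i).2
    + 1 ^ 2 * (c i + 2 * t * (p i).2 - t ^ 2 * (p i).1) = c i
  ring

/-- A solution of the recurrence is determined by its first two terms. The first two rows of the
Jacobian are (e + 1, 0) and (e t, 1), so any two initial values are attained once e + 1 is
invertible. -/
lemma exists_monomialJacobian_of_left [Algebra ℚ R] (t : R) (e : ℕ) (a : Fin (e + 2) → R)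
    (ha : (secondDifference 1 t e).mulVec a = 0) :
    ∃ x, (monomialJacobian 1 t e).mulVec x = a := by
  have hu : algebraMap ℚ R ((e + 1 : ℚ)⁻¹) * ((e : R) + 1) = 1 := by
    have : ((e : R) + 1) = algebraMap ℚ R (e + 1) := by simp
    rw [this, ← map_mul, inv_mul_cancel₀ (by positivity), map_one]
  set u := algebraMap ℚ R ((e + 1 : ℚ)⁻¹)
  refine ⟨![u * a 0, a 1 - e * t * (u * a 0)], ?_⟩
  rw [← sub_eq_zero]
  set b := (monomialJacobian 1 t e).mulVec ![u * a 0, a 1 - e * t * (u * a 0)] - a with hb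
  have hB : (secondDifference 1 t e).mulVec b = 0 := by
    rw [hb, Matrix.mulVec_sub, secondDifference_comp, ha, sub_zero]
  have h0 : b 0 = 0 := by
    simp only [hb, Pi.sub_apply, monomialJacobian_mulVec]
    simp
    linear_combination a 0 * hu
  have h1 : b 1 = 0 := by
    simp only [hb, Pi.sub_apply, monomialJacobian_mulVec]
    simp
  have key : ∀ i : ℕ, ∀ hi : i < e + 2, b ⟨i, hi⟩ = 0 := by
    intro i
    induction i using Nat.strong_induction_on with
    | _ i ih =>
      intro hi
      rcases i with _ | _ | i
      · exact h0
      · exact h1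
      · have h := congrFun hB ⟨i, by omega⟩
        rw [secondDifference_mulVec] at h
        have e0 := ih i (by omega) (by omega)
        have e1 := ih (i + 1) (by omega) (by omega)
        simp only [Fin.castSucc_mk, Fin.succ_mk, e0, e1] at h
        simpa using h
  ext i
  exact key i i.2

/-- Exchanging s and t reverses the list of monomials; this symmetry carries the results for s = 1
to the chart t = 1. -/
lemma secondDifference_rev (s t : R) (e : ℕ) (a : Fin (e + 2) → R) (i : Fin e) :
    (secondDifference s t e).mulVec (a ∘ Fin.rev) i = (secondDifference t s e).mulVec a i.rev := by
  simp only [secondDifference_mulVec, Function.comp_apply, Fin.rev_castSucc, Fin.rev_succ,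
    ← Fin.succ_castSucc]
  ring

lemma monomialJacobian_rev (s t : R) (e : ℕ) (x : Fin 2 → R) (i : Fin (e + 2)) :
    (monomialJacobian s t e).mulVec (x ∘ Fin.rev) i
      = (monomialJacobian t s e).mulVec x i.rev := by
  simp only [monomialJacobian_mulVec, Function.comp_apply, Fin.val_rev]
  obtain ⟨i, hi⟩ := i
  have h1 : e + 1 - (e + 2 - (i + 1)) = i := by omega
  have h2 : e - (e + 2 - (i + 1)) = i - 1 := by omega
  have h3 : e + 2 - (i + 1) = e + 1 - i := by omega
  have h4 : e + 1 - i - 1 = e - i := by omega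
  have r0 : Fin.rev (0 : Fin 2) = 1 := rfl
  have r1 : Fin.rev (1 : Fin 2) = 0 := rfl
  simp only [h1, h2, r0, r1]
  simp only [h3, h4]
  ring

lemma secondDifference_surjective_of_right (s : R) (e : ℕ) :
    Function.Surjective (secondDifference s 1 e).mulVec := by
  intro b
  obtain ⟨a, ha⟩ := secondDifference_surjective_of_left s e (b ∘ Fin.rev)
  refine ⟨a ∘ Fin.rev, ?_⟩
  ext i
  rw [secondDifference_rev, ha]
  simp

lemma exists_monomialJacobian_of_right [Algebra ℚ R] (s : R) (e : ℕ) (a : Fin (e + 2) → R)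
    (ha : (secondDifference s 1 e).mulVec a = 0) :
    ∃ x, (monomialJacobian s 1 e).mulVec x = a := by
  obtain ⟨x, hx⟩ := exists_monomialJacobian_of_left s e (a ∘ Fin.rev) (by
    ext i
    rw [secondDifference_rev, ha]
    rfl)
  refine ⟨x ∘ Fin.rev, ?_⟩
  ext i
  rw [monomialJacobian_rev, hx]
  simp

/-! ### Syzygies of the multiples of g together with h -/

/-- The Jacobian matrix of the forms `g * s ^ (e + 1 - i) * t ^ i` and `h`, in terms of the gradients
`dg` and `dh`. -/
def multipleJacobian (s t g : R) (dg dh : Fin 2 → R) (e : ℕ) :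
    Matrix (Fin (e + 2) ⊕ Fin 1) (Fin 2) R :=
  Matrix.fromRows
    (Matrix.of fun i j => g * monomialJacobian s t e i j
      + s ^ (e + 1 - i : ℕ) * t ^ (i : ℕ) * dg j)
    (Matrix.of fun _ => dh)

/-- The syzygies of `multipleJacobian`. -/
def syzygyMatrix (s t c : R) (e : ℕ) (q : Fin (e + 2) → R) :
    Matrix (Fin e ⊕ Fin 1) (Fin (e + 2) ⊕ Fin 1) R :=
  Matrix.fromBlocks (secondDifference s t e) 0 (Matrix.of fun _ => q) (Matrix.of fun _ _ => c)

lemma syzygyMatrix_map {S : Type*} [CommRing S] (φ : R →+* S) (s t c : R) (e : ℕ)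
    (q : Fin (e + 2) → R) :
    (syzygyMatrix s t c e q).map φ = syzygyMatrix (φ s) (φ t) (φ c) e (φ ∘ q) := by
  rw [syzygyMatrix, Matrix.fromBlocks_map, secondDifference_map, syzygyMatrix]
  congr 1
  ext i j
  simp

lemma multipleJacobian_map {S : Type*} [CommRing S] (φ : R →+* S) (s t g : R)
    (dg dh : Fin 2 → R) (e : ℕ) :
    (multipleJacobian s t g dg dh e).map φ =
      multipleJacobian (φ s) (φ t) (φ g) (φ ∘ dg) (φ ∘ dh) e := by
  ext (i | i) j
  · have := congrFun (congrFun (monomialJacobian_map φ s t e) i) j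
    simp only [Matrix.map_apply] at this
    simp [multipleJacobian, this]
  · simp [multipleJacobian]

lemma syzygyMatrix_mulVec (s t c : R) (e : ℕ) (q : Fin (e + 2) → R)
    (a : Fin (e + 2) → R) (z : Fin 1 → R) :
    (syzygyMatrix s t c e q).mulVec (Sum.elim a z) =
      Sum.elim ((secondDifference s t e).mulVec a) (fun _ => q ⬝ᵥ a + c * z 0) := by
  rw [syzygyMatrix, Matrix.fromBlocks_mulVec]
  congr 1
  · simp
  · ext i
    simp [Matrix.mulVec, dotProduct]

/-- The multiple of the gradients is a combination of gradients of monomials. -/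
lemma multipleJacobian_mulVec (s t g : R) (dg dh : Fin 2 → R) (e : ℕ)
    (u : R) (hu : u * ((e + 1 : ℕ) : R) = 1) (x : Fin 2 → R) :
    (multipleJacobian s t g dg dh e).mulVec x =
      Sum.elim ((monomialJacobian s t e).mulVec
        ![g * x 0 + u * s * (dg ⬝ᵥ x), g * x 1 + u * t * (dg ⬝ᵥ x)]) (fun _ => dh ⬝ᵥ x) := by
  rw [multipleJacobian, Matrix.fromRows_mulVec]
  congr 1
  ext i
  have h := monomialJacobian_euler s t e i
  simp only [Matrix.mulVec, dotProduct, Fin.sum_univ_two, Matrix.of_apply, Matrix.cons_val_zero,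
    Matrix.cons_val_one]
  linear_combination (-(u * (dg 0 * x 0 + dg 1 * x 1))) * h
    - s ^ (e + 1 - i : ℕ) * t ^ (i : ℕ) * (dg 0 * x 0 + dg 1 * x 1) * hu

/-- Exactness of the syzygies of `multipleJacobian`. -/
lemma syzygyMatrix_exact [Algebra ℚ R] {s t g n : R} {dg dh : Fin 2 → R} {e : ℕ}
    {q : Fin (e + 2) → R}
    (hs : Function.Surjective (secondDifference s t e).mulVec)
    (hk : ∀ a, (secondDifference s t e).mulVec a = 0 → ∃ x, (monomialJacobian s t e).mulVec x = a)
    (hg : s * dg 0 + t * dg 1 + (e + 1 : ℕ) * g = n * g)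
    (hq : ∀ x, q ⬝ᵥ (monomialJacobian s t e).mulVec x =
      (t * (dg 0 * dh 1 - dg 1 * dh 0) - (e + 1 : ℕ) * g * dh 0) * x 0 +
      (-(s * (dg 0 * dh 1 - dg 1 * dh 0)) - (e + 1 : ℕ) * g * dh 1) * x 1)
    (hu : ∃ α β γ, α * (t * (dg 0 * dh 1 - dg 1 * dh 0) - (e + 1 : ℕ) * g * dh 0) +
      β * (-(s * (dg 0 * dh 1 - dg 1 * dh 0)) - (e + 1 : ℕ) * g * dh 1) + γ * (n * g ^ 2) = 1) :
    Function.Exact (multipleJacobian s t g dg dh e).mulVec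
        (syzygyMatrix s t (n * g ^ 2) e q).mulVec ∧
      Function.Surjective (syzygyMatrix s t (n * g ^ 2) e q).mulVec := by
  obtain ⟨u, hue⟩ : ∃ u : R, u * ((e + 1 : ℕ) : R) = 1 := by
    refine ⟨algebraMap ℚ R ((e + 1 : ℚ)⁻¹), ?_⟩
    have : ((e + 1 : ℕ) : R) = algebraMap ℚ R (e + 1) := by simp
    rw [this, ← map_mul, inv_mul_cancel₀ (by positivity), map_one]
  obtain ⟨α, β, γ, hu⟩ := hu
  set d : R := ((e + 1 : ℕ) : R) with hd
  refine ⟨?_, ?_⟩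
  · intro y
    constructor
    · intro hy
      obtain ⟨a, z, rfl⟩ : ∃ a z, y = Sum.elim a z :=
        ⟨y ∘ Sum.inl, y ∘ Sum.inr, (Sum.elim_comp_inl_inr y).symm⟩
      rw [syzygyMatrix_mulVec] at hy
      obtain ⟨x, rfl⟩ := hk a (funext fun i => congrFun hy (Sum.inl i))
      have h2 : q ⬝ᵥ (monomialJacobian s t e).mulVec x + n * g ^ 2 * z 0 = 0 :=
        congrFun hy (Sum.inr 0)
      rw [hq] at h2
      -- `v × w` paired with the columns of the reduced Jacobian matrix
      set w0 : R := x 1 * γ - z 0 * β with hw0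
      set w1 : R := z 0 * α - x 0 * γ with hw1
      set w2 : R := x 0 * β - x 1 * α with hw2
      -- Let v be the vector of minors, y = (x 0, x 1, z 0) and w = y × (α, β, γ). Then v × w = y (v
      -- · (α, β, γ)) - (α, β, γ)(v · y) = y. With C₀, C₁ the columns of the reduced matrix scaled
      -- by d, one has C₀ × C₁ = d v, so d (v × w) = C₁ (C₀ · w) - C₀ (C₁ · w); the coefficients are
      -- the witness.
      refine ⟨![-((s * dg 1) * w0 + (d * g + t * dg 1) * w1 + d * dh 1 * w2),
        ((d * g + s * dg 0) * w0 + (t * dg 0) * w1 + d * dh 0 * w2)], ?_⟩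
      rw [multipleJacobian_mulVec s t g dg dh e u hue]
      set X0 : R := -((s * dg 1) * w0 + (d * g + t * dg 1) * w1 + d * dh 1 * w2) with hX0
      set X1 : R := (d * g + s * dg 0) * w0 + (t * dg 0) * w1 + d * dh 0 * w2 with hX1
      set W : R := dg 0 * dh 1 - dg 1 * dh 0 with hW
      have c0 : g * X0 + u * s * (dg ⬝ᵥ ![X0, X1]) = x 0 := by
        simp only [dotProduct, Fin.sum_univ_two, Matrix.cons_val_zero, Matrix.cons_val_one]
        linear_combination (-g * X0 + ((-(s * W) - d * g * dh 1) * w2 - n * g ^ 2 * w1)) * hue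
          - u * d * g * w1 * hg + x 0 * hu - α * h2
      have c1 : g * X1 + u * t * (dg ⬝ᵥ ![X0, X1]) = x 1 := by
        simp only [dotProduct, Fin.sum_univ_two, Matrix.cons_val_zero, Matrix.cons_val_one]
        linear_combination (-g * X1 + (n * g ^ 2 * w0 - (t * W - d * g * dh 0) * w2)) * hue
          + u * d * g * w0 * hg + x 1 * hu - β * h2
      have c2 : dh ⬝ᵥ ![X0, X1] = z 0 := by
        simp only [dotProduct, Fin.sum_univ_two, Matrix.cons_val_zero, Matrix.cons_val_one]
        linear_combination ((t * W - d * g * dh 0) * w1 - (-(s * W) - d * g * dh 1) * w0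
          - (dh 0 * X0 + dh 1 * X1)) * hue + z 0 * hu - γ * h2
      rw [c2]
      congr 1
      · congr 1
        ext i
        fin_cases i
        · exact c0
        · exact c1
      · ext i
        obtain rfl : i = 0 := Subsingleton.elim _ _
        rfl
    · rintro ⟨x, rfl⟩
      rw [multipleJacobian_mulVec s t g dg dh e u hue, syzygyMatrix_mulVec, secondDifference_comp]
      ext (i | i)
      · rfl
      · simp only [Sum.elim_inr, hq, Pi.zero_apply, Matrix.cons_val_zero, Matrix.cons_val_one]
        simp only [dotProduct, Fin.sum_univ_two]
        linear_combination -g * (dg 0 * x 0 + dg 1 * x 1) * (s * dh 0 + t * dh 1) * hue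
          - g * (dh 0 * x 0 + dh 1 * x 1) * hg
  · intro y
    obtain ⟨a, ha⟩ := hs (y ∘ Sum.inl)
    set c := y (Sum.inr 0) - q ⬝ᵥ a with hc
    -- The correction leaves the second differences unchanged and, by the Bézout relation, adds
    -- exactly c to the last coordinate.
    refine ⟨Sum.elim (a + (monomialJacobian s t e).mulVec ![c * α, c * β]) (fun _ => c * γ), ?_⟩
    rw [syzygyMatrix_mulVec, Matrix.mulVec_add, secondDifference_comp, add_zero, ha]
    ext (i | i)
    · rfl
    · obtain rfl : i = 0 := Subsingleton.elim _ _
      simp only [Sum.elim_inr, dotProduct_add, hq, Matrix.cons_val_zero, Matrix.cons_val_one]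
      linear_combination c * hu + hc

end Matrices

/-! ### Lifting pairs of forms through the monomial gradients -/

section Lifting

open MvPolynomial

/-- A homogeneous binary form is a sum of terms divisible by monomials of a given smaller degree. -/
lemma IsHomogeneous.binary_induction {r d : ℕ} {p : MvPolynomial (Fin 2) ℂ → Prop}
    (h0 : p 0) (hadd : ∀ P Q, p P → p Q → p (P + Q))
    (hmon : ∀ (P : MvPolynomial (Fin 2) ℂ) (i : ℕ), P.IsHomogeneous r → i ≤ d →
      p (P * (X 0 ^ (d - i) * X 1 ^ i)))
    {P : MvPolynomial (Fin 2) ℂ} (hP : P.IsHomogeneous (r + d)) : p P := by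
  rw [P.as_sum]
  refine Finset.sum_induction _ p hadd h0 fun m hm => ?_
  have hdeg : m 0 + m 1 = r + d := by
    have := hP.degree_eq_sum_deg_support hm
    rw [this, ← Finsupp.degree_apply, Finsupp.degree_eq_sum, Fin.sum_univ_two]
  -- The factor of degree d takes as many powers of `X 1` as possible.
  obtain ⟨i, hi, h1, h2⟩ : ∃ i ≤ d, i ≤ m 1 ∧ d - i ≤ m 0 :=
    ⟨min d (m 1), by omega, by omega, by omega⟩
  have := hmon (C (P.coeff m) * (X 0 ^ (m 0 - (d - i)) * X 1 ^ (m 1 - i))) i ?_ hi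
  · convert this using 1
    rw [monomial_eq, Finsupp.prod_fintype _ _ (by simp), Fin.prod_univ_two]
    have e0 : (X 0 : MvPolynomial (Fin 2) ℂ) ^ m 0 = X 0 ^ (m 0 - (d - i)) * X 0 ^ (d - i) := by
      rw [← pow_add]; congr 1; omega
    have e1 : (X 1 : MvPolynomial (Fin 2) ℂ) ^ m 1 = X 1 ^ (m 1 - i) * X 1 ^ i := by
      rw [← pow_add]; congr 1; omega
    rw [e0, e1]
    ring
  · convert (isHomogeneous_C (Fin 2) (P.coeff m)).mul
      ((isHomogeneous_X_pow (R := ℂ) (0 : Fin 2) (m 0 - (d - i))).mul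
      (isHomogeneous_X_pow (R := ℂ) (1 : Fin 2) (m 1 - i))) using 1
    omega

/-- With i + j = e, both t∇mᵢ and s∇mᵢ₊₁ are combinations of (s^j t^(i+1), 0) and (0, s^(j+1) t^i),
with coefficients (j+1, i) and (j, i+1). The determinant (j+1)(i+1) - ij = e + 1 is invertible, so
both vectors are attained. The remaining vectors (s^(e+1), 0) and (0, t^(e+1)) come from s∇m₀ and
t∇mₑ₊₁. -/
lemma exists_vecMul_monomialJacobian (e r : ℕ) {A B : MvPolynomial (Fin 2) ℂ}
    (hA : A.IsHomogeneous (r + (e + 1))) (hB : B.IsHomogeneous (r + (e + 1))) :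
    ∃ q : Fin (e + 2) → MvPolynomial (Fin 2) ℂ, (∀ i, (q i).IsHomogeneous (r + 1)) ∧
      Matrix.vecMul q (monomialJacobian (X 0) (X 1) e) = ![A, B] := by
  have hadd : ∀ {v w : Fin 2 → MvPolynomial (Fin 2) ℂ},
      (∃ q : Fin (e + 2) → MvPolynomial (Fin 2) ℂ, (∀ i, (q i).IsHomogeneous (r + 1)) ∧
        Matrix.vecMul q (monomialJacobian (X 0) (X 1) e) = v) →
      (∃ q : Fin (e + 2) → MvPolynomial (Fin 2) ℂ, (∀ i, (q i).IsHomogeneous (r + 1)) ∧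
        Matrix.vecMul q (monomialJacobian (X 0) (X 1) e) = w) →
      (∃ q : Fin (e + 2) → MvPolynomial (Fin 2) ℂ, (∀ i, (q i).IsHomogeneous (r + 1)) ∧
        Matrix.vecMul q (monomialJacobian (X 0) (X 1) e) = v + w) := by
    rintro v w ⟨q, hq, rfl⟩ ⟨q', hq', rfl⟩
    exact ⟨q + q', fun i => (hq i).add (hq' i), Matrix.add_vecMul _ _ _⟩
  have hzero : ∃ q : Fin (e + 2) → MvPolynomial (Fin 2) ℂ, (∀ i, (q i).IsHomogeneous (r + 1)) ∧
        Matrix.vecMul q (monomialJacobian (X 0) (X 1) e) = 0 :=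
    ⟨0, fun i => isHomogeneous_zero _ _ _, Matrix.zero_vecMul _⟩
  have hsingle : ∀ (i : Fin (e + 2)) (j : Fin 2) (c : ℂ) {P : MvPolynomial (Fin 2) ℂ},
      P.IsHomogeneous r → ∃ q : Fin (e + 2) → MvPolynomial (Fin 2) ℂ,
        (∀ i, (q i).IsHomogeneous (r + 1)) ∧ Matrix.vecMul q (monomialJacobian (X 0) (X 1) e) =
          (C c * P * X j) • monomialJacobian (X 0) (X 1) e i := by
    intro i j c P hP
    refine ⟨Pi.single i (C c * P * X j), fun k => ?_, Matrix.single_vecMul _ _ _⟩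
    by_cases hk : k = i
    · subst hk
      rw [Pi.single_eq_same]
      have := ((isHomogeneous_C (Fin 2) c).mul hP).mul (isHomogeneous_X ℂ j)
      rwa [zero_add] at this
    · rw [Pi.single_eq_of_ne hk]
      exact isHomogeneous_zero _ _ _
  have hd : (C ((e + 1 : ℂ)⁻¹) : MvPolynomial (Fin 2) ℂ) * ((e : MvPolynomial (Fin 2) ℂ) + 1) = 1 := by
    have h : (e : MvPolynomial (Fin 2) ℂ) + 1 = C ((e : ℂ) + 1) := by simp
    rw [h, ← C_mul, inv_mul_cancel₀ (by exact_mod_cast e.succ_ne_zero), C_1]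
  have h00 : (![0, 0] : Fin 2 → MvPolynomial (Fin 2) ℂ) = 0 := by simp
  have hB' := IsHomogeneous.binary_induction (p := fun B => ∃ q : Fin (e + 2) → MvPolynomial (Fin 2) ℂ,
    (∀ i, (q i).IsHomogeneous (r + 1)) ∧
      Matrix.vecMul q (monomialJacobian (X 0) (X 1) e) = ![0, B]) (by rwa [h00])
    (fun P Q hP hQ => by simpa using hadd hP hQ) (fun P i hP hi => ?_) hB
  have hA' := IsHomogeneous.binary_induction (p := fun A => ∃ q : Fin (e + 2) → MvPolynomial (Fin 2) ℂ,
    (∀ i, (q i).IsHomogeneous (r + 1)) ∧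
      Matrix.vecMul q (monomialJacobian (X 0) (X 1) e) = ![A, 0]) (by rwa [h00])
    (fun P Q hP hQ => by simpa using hadd hP hQ) (fun P i hP hi => ?_) hA
  · simpa using hadd hA' hB'
  · rcases i with _ | i
    · obtain ⟨q, hq, h⟩ := hsingle 0 0 ((e + 1 : ℂ)⁻¹) hP
      refine ⟨q, hq, h.trans ?_⟩
      ext j : 1
      fin_cases j
      · simp [monomialJacobian, -mul_eq_mul_right_iff, -mul_eq_mul_left_iff]
        linear_combination (P * X 0 ^ (e + 1)) * hd
      · simp [monomialJacobian]
    · obtain ⟨j, rfl⟩ := Nat.exists_eq_add_of_le (Nat.le_of_succ_le_succ hi)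
      obtain ⟨q, hq, h⟩ := hadd
        (hsingle ⟨i, by omega⟩ 1 (((i + j : ℕ) + 1 : ℂ)⁻¹ * (i + 1)) hP)
        (hsingle ⟨i + 1, by omega⟩ 0 (((i + j : ℕ) + 1 : ℂ)⁻¹ * (-i)) hP)
      refine ⟨q, hq, h.trans ?_⟩
      have h1 : i + j + 1 - i = j + 1 := by omega
      have h2 : i + j - i = j := by omega
      have h3 : i + j - (i + 1) = j - 1 := by omega
      have h4 : i + j + 1 - (i + 1) = j := by omega
      ext l : 1
      fin_cases l
      · simp only [monomialJacobian, Matrix.of_apply, Pi.add_apply, Pi.smul_apply, smul_eq_mul, h1,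
          h2, h3, h4, C_mul, Fin.zero_eta, Matrix.cons_val_zero]
        rcases j with _ | j
        · simp only [map_add, map_neg, map_one, map_natCast, Nat.cast_add, Nat.cast_one,
            Nat.cast_zero] at hd ⊢
          linear_combination (P * X 1 ^ (i + 1)) * hd
        · simp only [map_add, map_neg, map_one, map_natCast, Nat.cast_add, Nat.cast_one,
            Nat.add_sub_cancel] at hd ⊢
          linear_combination (P * X 0 ^ (j + 1) * X 1 ^ (i + 1)) * hd
      · simp only [monomialJacobian, Matrix.of_apply, Pi.add_apply, Pi.smul_apply, smul_eq_mul, h1,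
          h2, h3, h4, C_mul, Fin.mk_one, Matrix.cons_val_one, Matrix.cons_val_fin_one]
        rcases i with _ | i
        · simp
        · simp only [map_add, map_neg, map_one, map_natCast, Nat.cast_add, Nat.cast_one,
            Nat.add_sub_cancel]
          ring
  · rcases hi.eq_or_lt with rfl | hi
    · obtain ⟨q, hq, h⟩ := hsingle (Fin.last _) 1 ((e + 1 : ℂ)⁻¹) hP
      refine ⟨q, hq, h.trans ?_⟩
      ext j : 1
      fin_cases j
      · simp [monomialJacobian]
      · simp [monomialJacobian, -mul_eq_mul_right_iff, -mul_eq_mul_left_iff]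
        linear_combination (P * X 1 ^ (e + 1)) * hd
    · obtain ⟨j, rfl⟩ := Nat.exists_eq_add_of_le (Nat.le_of_lt_succ hi)
      obtain ⟨q, hq, h⟩ := hadd
        (hsingle ⟨i + 1, by omega⟩ 0 (((i + j : ℕ) + 1 : ℂ)⁻¹ * (j + 1)) hP)
        (hsingle ⟨i, by omega⟩ 1 (((i + j : ℕ) + 1 : ℂ)⁻¹ * (-j)) hP)
      refine ⟨q, hq, h.trans ?_⟩
      have h1 : i + j + 1 - i = j + 1 := by omega
      have h2 : i + j - i = j := by omega
      have h3 : i + j - (i + 1) = j - 1 := by omega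
      have h4 : i + j + 1 - (i + 1) = j := by omega
      ext l : 1
      fin_cases l
      · simp only [monomialJacobian, Matrix.of_apply, Pi.add_apply, Pi.smul_apply, smul_eq_mul, h1,
          h2, h3, h4, C_mul, Fin.zero_eta, Matrix.cons_val_zero]
        rcases j with _ | j
        · simp
        · simp only [map_add, map_neg, map_one, map_natCast, Nat.cast_add, Nat.cast_one,
            Nat.add_sub_cancel]
          ring
      · simp only [monomialJacobian, Matrix.of_apply, Pi.add_apply, Pi.smul_apply, smul_eq_mul, h1,
          h2, h3, h4, C_mul, Fin.mk_one, Matrix.cons_val_one, Matrix.cons_val_fin_one]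
        rcases i with _ | i
        · simp only [map_add, map_neg, map_one, map_natCast, Nat.cast_add, Nat.cast_one,
            Nat.cast_zero, Nat.add_sub_cancel] at hd ⊢
          linear_combination (P * X 0 ^ (j + 1)) * hd
        · simp only [map_add, map_neg, map_one, map_natCast, Nat.cast_add, Nat.cast_one,
            Nat.add_sub_cancel] at hd ⊢
          linear_combination (P * X 0 ^ (j + 1) * X 1 ^ (i + 1)) * hd

end Lifting

/-! ### The presentation by binary forms on the charts -/

open MvPolynomial

/-- Three binary forms without common zeros generate the unit ideal on a chart. -/
lemma exists_bezout_of_no_common_zero (φ : MvPolynomial (Fin 2) ℂ →ₐ[ℂ] ℂ[X])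
    (hφ : ∀ z : ℂ, ∃ x : Fin 2 → ℂ, x ≠ 0 ∧ ∀ P, (φ P).eval z = eval x P)
    {A B C : MvPolynomial (Fin 2) ℂ}
    (h : ∀ x : Fin 2 → ℂ, x ≠ 0 → eval x A = 0 → eval x B = 0 → eval x C ≠ 0) :
    ∃ α β γ, α * φ A + β * φ B + γ * φ C = 1 := by
  have htop : Ideal.span {φ A, φ B, φ C} = (⊤ : Ideal ℂ[X]) := by
    obtain ⟨p, hp⟩ := IsPrincipalIdealRing.principal (Ideal.span {φ A, φ B, φ C})
    have hp' : Ideal.span {φ A, φ B, φ C} = Ideal.span {p} := hp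
    rw [hp', Ideal.span_singleton_eq_top]
    by_contra hu
    have hdvd : ∀ q ∈ ({φ A, φ B, φ C} : Set ℂ[X]), p ∣ q := fun q hq => by
      rw [← Ideal.mem_span_singleton, ← hp']
      exact Ideal.subset_span hq
    obtain ⟨z, hz⟩ : ∃ z, p.IsRoot z := by
      by_cases h0 : p = 0
      · exact ⟨0, by simp [h0]⟩
      · exact IsAlgClosed.exists_root p fun hd => hu (Polynomial.isUnit_iff_degree_eq_zero.2 hd)
    obtain ⟨x, hx, hxz⟩ := hφ z
    have hv : ∀ q ∈ ({φ A, φ B, φ C} : Set ℂ[X]), q.eval z = 0 := fun q hq =>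
      Polynomial.eval_eq_zero_of_dvd_of_eval_eq_zero (hdvd q hq) hz
    exact h x hx (by rw [← hxz]; exact hv _ (by simp)) (by rw [← hxz]; exact hv _ (by simp))
      (by rw [← hxz]; exact hv _ (by simp))
  have h1 : (1 : ℂ[X]) ∈ Ideal.span {φ A, φ B, φ C} := htop ▸ Submodule.mem_top
  rw [Ideal.mem_span_insert] at h1
  obtain ⟨α, w, hw, h1⟩ := h1
  rw [Ideal.mem_span_pair] at hw
  obtain ⟨β, γ, rfl⟩ := hw
  exact ⟨α, β, γ, by rw [h1]; ring⟩

lemma eval_dehom₀ (z : ℂ) (P : MvPolynomial (Fin 2) ℂ) :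
    (dehom₀ P).eval z = eval ![1, z] P := by
  induction P using MvPolynomial.induction_on with
  | C a => simp [dehom₀]
  | add p q hp hq => simp [hp, hq]
  | mul_X p i hp => fin_cases i <;> simp [hp] <;> simp [dehom₀]

lemma eval_dehom₁ (z : ℂ) (P : MvPolynomial (Fin 2) ℂ) :
    (dehom₁ P).eval z = eval ![z, 1] P := by
  induction P using MvPolynomial.induction_on with
  | C a => simp [dehom₁]
  | add p q hp hq => simp [hp, hq]
  | mul_X p i hp => fin_cases i <;> simp [hp] <;> simp [dehom₁]

lemma euler_two {P : MvPolynomial (Fin 2) ℂ} {n : ℕ} (h : P.IsHomogeneous n) :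
    X 0 * pderiv 0 P + X 1 * pderiv 1 P = (n : MvPolynomial (Fin 2) ℂ) * P := by
  have := h.sum_X_mul_pderiv
  rw [Fin.sum_univ_two] at this
  rw [this, nsmul_eq_mul]

lemma pderiv_monomial_eq_monomialJacobian (e : ℕ) (l : Fin (e + 2)) (i : Fin 2) :
    pderiv i (X 0 ^ (e + 1 - l : ℕ) * X 1 ^ (l : ℕ) : MvPolynomial (Fin 2) ℂ) =
      monomialJacobian (X 0) (X 1) e l i := by
  have h01 : pderiv (0 : Fin 2) (X 1 : MvPolynomial (Fin 2) ℂ) = 0 := pderiv_X_of_ne (by decide)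
  have h10 : pderiv (1 : Fin 2) (X 0 : MvPolynomial (Fin 2) ℂ) = 0 := pderiv_X_of_ne (by decide)
  have he : e + 1 - (l : ℕ) - 1 = e - l := by omega
  fin_cases i
  · simp only [Fin.zero_eta, monomialJacobian, Matrix.of_apply, Matrix.cons_val_zero, pderiv_mul,
      pderiv_pow, h01, pderiv_X_self, he]
    ring
  · simp only [Fin.mk_one, monomialJacobian, Matrix.of_apply, Matrix.cons_val_one,
      Matrix.cons_val_fin_one, pderiv_mul, pderiv_pow, h10, pderiv_X_self]
    ring

/-- The Jacobian matrix of the multiples of `g` by monomials of degree `e + 1`, together with `h`,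
has a matrix of syzygies that presents its cokernel on both charts. -/
lemma exists_syzygyMatrix {k e : ℕ} {g h : MvPolynomial (Fin 2) ℂ}
    (hg : g.IsHomogeneous (k + 1)) (hh : h.IsHomogeneous (k + e + 2))
    (hW : ∀ x : Fin 2 → ℂ, x ≠ 0 → eval x g = 0 →
      eval x (pderiv 0 g * pderiv 1 h - pderiv 1 g * pderiv 0 h) ≠ 0) :
    ∃ Q : Matrix (Fin e ⊕ Fin 1) (Fin (e + 2) ⊕ Fin 1) (MvPolynomial (Fin 2) ℂ),
      (∀ j l, (Q j l).IsHomogeneous (Sum.elim (fun _ => 2) (fun _ => 2 * k + 2) j)) ∧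
      ∀ φ : MvPolynomial (Fin 2) ℂ →ₐ[ℂ] ℂ[X], φ = dehom₀ ∨ φ = dehom₁ →
        Function.Exact ((multipleJacobian (X 0) (X 1) g (fun i => pderiv i g)
          (fun i => pderiv i h) e).map φ).mulVec (Q.map φ).mulVec ∧
        Function.Surjective (Q.map φ).mulVec := by
  set W := pderiv 0 g * pderiv 1 h - pderiv 1 g * pderiv 0 h with hWdef
  set n : ℕ := k + e + 2 with hn
  have hg' : ∀ i, (pderiv i g).IsHomogeneous k := fun i => hg.pderiv
  have hh' : ∀ i, (pderiv i h).IsHomogeneous (k + e + 1) := fun i => hh.pderiv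
  have hWh : W.IsHomogeneous (k + (k + e + 1)) :=
    ((hg' 0).mul (hh' 1)).sub ((hg' 1).mul (hh' 0))
  have hgh : ∀ i, (((e + 1 : ℕ) : MvPolynomial (Fin 2) ℂ) * g * pderiv i h).IsHomogeneous
      (2 * k + 1 + (e + 1)) := fun i => by
    have := ((isHomogeneous_C (Fin 2) ((e + 1 : ℕ) : ℂ)).mul hg).mul (hh' i)
    rw [map_natCast] at this
    convert this using 1
    ring
  have hXW : ∀ i : Fin 2, (X i * W).IsHomogeneous (2 * k + 1 + (e + 1)) := fun i => by
    convert (isHomogeneous_X ℂ i).mul hWh using 1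
    ring
  -- The lifted pair consists of the two minors of the reduced matrix that involve h.
  obtain ⟨q, hq, hqJ⟩ := exists_vecMul_monomialJacobian e (2 * k + 1)
    ((hXW 1).sub (hgh 0)) ((hXW 0).neg.sub (hgh 1))
  refine ⟨syzygyMatrix (X 0) (X 1) ((n : MvPolynomial (Fin 2) ℂ) * g ^ 2) e q, ?_, ?_⟩
  · have hX : ∀ i : Fin 2, (X i ^ 2 : MvPolynomial (Fin 2) ℂ).IsHomogeneous 2 := fun i =>
      isHomogeneous_X_pow i 2
    have hX2 : (-(2 * X 0 * X 1) : MvPolynomial (Fin 2) ℂ).IsHomogeneous 2 := by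
      have := ((isHomogeneous_C (Fin 2) (2 : ℂ)).mul (isHomogeneous_X ℂ (0 : Fin 2))).mul
        (isHomogeneous_X ℂ (1 : Fin 2))
      rw [map_ofNat] at this
      exact this.neg
    have hsingle : ∀ (i l : Fin (e + 2)) {P : MvPolynomial (Fin 2) ℂ}, P.IsHomogeneous 2 →
        ((Pi.single i P : Fin (e + 2) → _) l).IsHomogeneous 2 := fun i l P hP => by
      rw [Pi.single_apply]
      split_ifs
      exacts [hP, isHomogeneous_zero _ _ _]
    rintro (j | j) (l | l)
    · exact ((hsingle _ l (hX 1)).add (hsingle _ l hX2)).add (hsingle _ l (hX 0))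
    · exact isHomogeneous_zero _ _ _
    · exact hq l
    · have := (isHomogeneous_C (Fin 2) (n : ℂ)).mul (hg.pow 2)
      rw [map_natCast] at this
      simp only [syzygyMatrix, Matrix.fromBlocks_apply₂₂, Matrix.of_apply, Sum.elim_inr]
      convert this using 1
      ring
  · intro φ hφ
    have hE : X 0 * pderiv 0 g + X 1 * pderiv 1 g + ((e + 1 : ℕ) : MvPolynomial (Fin 2) ℂ) * g =
        (n : MvPolynomial (Fin 2) ℂ) * g := by
      rw [euler_two hg, hn]
      push_cast
      ring
    have hroot : ∀ z : ℂ, ∃ x : Fin 2 → ℂ, x ≠ 0 ∧ ∀ P, (φ P).eval z = eval x P := by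
      intro z
      rcases hφ with rfl | rfl
      · exact ⟨![1, z], fun h => by simpa using congrFun h 0, eval_dehom₀ z⟩
      · exact ⟨![z, 1], fun h => by simpa using congrFun h 1, eval_dehom₁ z⟩
    have hbez := exists_bezout_of_no_common_zero φ hroot
      (A := X 1 * W - ((e + 1 : ℕ) : MvPolynomial (Fin 2) ℂ) * g * pderiv 0 h)
      (B := -(X 0 * W) - ((e + 1 : ℕ) : MvPolynomial (Fin 2) ℂ) * g * pderiv 1 h)
      (C := (n : MvPolynomial (Fin 2) ℂ) * g ^ 2) (by
        -- The third minor forces g = 0 at x; the other two then reduce to multiples of W by the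
        -- coordinates, and W ≠ 0 makes both coordinates vanish.
        intro x hx hA hB hC
        have hn0 : (n : ℂ) ≠ 0 := by exact_mod_cast Nat.succ_ne_zero (k + e + 1)
        have hgx : eval x g = 0 := by simpa [hn0] using hC
        have hWx := hW x hx hgx
        simp only [map_sub, map_mul, map_neg, hgx, eval_X, mul_zero, zero_mul, sub_zero,
          neg_eq_zero, mul_eq_zero, hWx, or_false] at hA hB
        exact hx (by ext i; fin_cases i; exacts [hB, hA]))
    have hmJ := multipleJacobian_map φ.toRingHom (X 0) (X 1) g (fun i => pderiv i g)
      (fun i => pderiv i h) e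
    have hmQ := syzygyMatrix_map φ.toRingHom (X 0) (X 1) ((n : MvPolynomial (Fin 2) ℂ) * g ^ 2) e q
    have e1 : φ.toRingHom ((n : MvPolynomial (Fin 2) ℂ) * g ^ 2) = (n : ℂ[X]) * φ g ^ 2 := by simp
    rw [e1] at hmQ
    change Function.Exact ((multipleJacobian (X 0) (X 1) g (fun i => pderiv i g)
          (fun i => pderiv i h) e).map φ.toRingHom).mulVec
        ((syzygyMatrix (X 0) (X 1) ((n : MvPolynomial (Fin 2) ℂ) * g ^ 2) e q).map φ.toRingHom).mulVec ∧
      Function.Surjective ((syzygyMatrix (X 0) (X 1) ((n : MvPolynomial (Fin 2) ℂ) * g ^ 2) e q).map φ.toRingHom).mulVec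
    rw [hmJ, hmQ]
    apply syzygyMatrix_exact
    · rcases hφ with rfl | rfl
      · simpa [dehom₀] using secondDifference_surjective_of_left (Polynomial.X : ℂ[X]) e
      · simpa [dehom₁] using secondDifference_surjective_of_right (Polynomial.X : ℂ[X]) e
    · rcases hφ with rfl | rfl
      · simpa [dehom₀] using exists_monomialJacobian_of_left (Polynomial.X : ℂ[X]) e
      · simpa [dehom₁] using exists_monomialJacobian_of_right (Polynomial.X : ℂ[X]) e
    · simpa using congrArg φ hE
    · intro x
      have h1 := congrArg (fun v : Fin 2 → MvPolynomial (Fin 2) ℂ => φ.toRingHom ∘ v) hqJ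
      have h2 : φ.toRingHom ∘ Matrix.vecMul q (monomialJacobian (X 0) (X 1) e) =
          Matrix.vecMul (φ.toRingHom ∘ q)
            (monomialJacobian (φ.toRingHom (X 0)) (φ.toRingHom (X 1)) e) := by
        rw [← monomialJacobian_map]
        ext1 i
        exact RingHom.map_vecMul φ.toRingHom _ _ i
      simp only [h2] at h1
      rw [Matrix.dotProduct_mulVec, h1]
      simp [dotProduct, Fin.sum_univ_two, hWdef]
    · simpa [hWdef] using hbez

/-- The normal sheaf of a curve that becomes, after a change of coordinates, the curve given by the
multiples of `g` by monomials and by `h`. -/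
lemma nonempty_normalSheaf_iso {k e : ℕ} {g h : MvPolynomial (Fin 2) ℂ}
    (hg : g.IsHomogeneous (k + 1)) (hh : h.IsHomogeneous (k + e + 2))
    (hW : ∀ x : Fin 2 → ℂ, x ≠ 0 → eval x g = 0 →
      eval x (pderiv 0 g * pderiv 1 h - pderiv 1 g * pderiv 0 h) ≠ 0)
    (F : Fin (e + 2 + 1) → MvPolynomial (Fin 2) ℂ) (hF : ∀ j, (F j).IsHomogeneous (k + e + 2))
    (H : Matrix (Fin (e + 2) ⊕ Fin 1) (Fin (e + 2 + 1)) ℂ)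
    (H' : Matrix (Fin (e + 2 + 1)) (Fin (e + 2) ⊕ Fin 1) ℂ) (h1 : H * H' = 1) (h2 : H' * H = 1)
    (hH₁ : ∀ i : Fin (e + 2), g * (X 0 ^ (e + 1 - i : ℕ) * X 1 ^ (i : ℕ)) =
      ∑ j, C (H (Sum.inl i) j) * F j)
    (hH₂ : h = ∑ j, C (H (Sum.inr 0) j) * F j) :
    Nonempty ((normalSheaf F hF).Iso
      (sumO (Sum.elim (fun _ : Fin e => ((k + e + 2 : ℕ) : ℤ) + 2)
        (fun _ : Fin 1 => ((k + e + 2 : ℕ) : ℤ) + 2 + 2 * (k : ℤ))))) := by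
  obtain ⟨Q, hQ, hQφ⟩ := exists_syzygyMatrix hg hh hW
  have hJ : multipleJacobian (X 0) (X 1) g (fun i => pderiv i g) (fun i => pderiv i h) e =
      H.map (C : ℂ → MvPolynomial (Fin 2) ℂ) * jacobian F := by
    refine Matrix.ext fun l i => ?_
    rw [Matrix.mul_apply]
    rcases l with l | l
    · have := congrArg (pderiv i) (hH₁ l)
      rw [map_sum] at this
      simp only [pderiv_C_mul] at this
      simp only [jacobian, Matrix.map_apply]
      rw [← this]
      simp only [multipleJacobian, Matrix.fromRows_apply_inl, Matrix.of_apply]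
      rw [Derivation.leibniz, smul_eq_mul, smul_eq_mul]
      rw [pderiv_monomial_eq_monomialJacobian]
    · obtain rfl : l = 0 := Subsingleton.elim _ _
      have := congrArg (pderiv i) hH₂
      rw [map_sum] at this
      simp only [pderiv_C_mul] at this
      simp only [jacobian, Matrix.map_apply]
      rw [← this]
      rfl
  have hQ' : ∀ j l, ((Q * H.map (C : ℂ → MvPolynomial (Fin 2) ℂ)) j l).IsHomogeneous
      (Sum.elim (fun _ => 2) (fun _ => 2 * k + 2) j) := by
    intro j l
    rw [Matrix.mul_apply]
    refine IsHomogeneous.sum _ _ _ fun i _ => ?_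
    exact (hQ j i).mul (isHomogeneous_C _ _)
  have key : ∀ φ : MvPolynomial (Fin 2) ℂ →ₐ[ℂ] ℂ[X], φ = dehom₀ ∨ φ = dehom₁ →
      Function.Exact ((jacobian F).map φ).mulVecLin ((Q * H.map (C : ℂ → MvPolynomial (Fin 2) ℂ)).map φ).mulVecLin ∧
      Function.Surjective ((Q * H.map (C : ℂ → MvPolynomial (Fin 2) ℂ)).map φ).mulVecLin := by
    intro φ hφ
    obtain ⟨hex, hsurj⟩ := hQφ φ hφ
    set G := (H.map (C : ℂ → MvPolynomial (Fin 2) ℂ)).map φ with hG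
    set G' := (H'.map (C : ℂ → MvPolynomial (Fin 2) ℂ)).map φ with hG'
    have g1 : G * G' = 1 := by
      have := congrArg (fun M => M.map (φ.toRingHom.comp C)) h1
      simp only [Matrix.map_mul, Matrix.map_one _ (map_zero _) (map_one _)] at this
      exact this
    have g2 : G' * G = 1 := by
      have := congrArg (fun M => M.map (φ.toRingHom.comp C)) h2
      simp only [Matrix.map_mul, Matrix.map_one _ (map_zero _) (map_one _)] at this
      exact this
    rw [hJ, Matrix.map_mul, ← hG] at hex
    rw [Matrix.map_mul, ← hG]
    -- Both properties transfer along the invertible change of coordinates `G`.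
    refine ⟨fun y => ?_, fun y => ?_⟩
    · rw [Matrix.mulVecLin_apply, ← Matrix.mulVec_mulVec, hex]
      constructor
      · rintro ⟨x, hx⟩
        refine ⟨x, ?_⟩
        rw [← Matrix.mulVec_mulVec] at hx
        have := congrArg G'.mulVec hx
        rwa [Matrix.mulVec_mulVec, g2, Matrix.one_mulVec, Matrix.mulVec_mulVec, g2,
          Matrix.one_mulVec] at this
      · rintro ⟨x, rfl⟩
        exact ⟨x, (Matrix.mulVec_mulVec _ _ _).symm⟩
    · obtain ⟨x, rfl⟩ := hsurj y
      refine ⟨G'.mulVec x, ?_⟩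
      rw [Matrix.mulVecLin_apply, Matrix.mulVec_mulVec, Matrix.mul_assoc, g1,
        Matrix.mul_one]
  refine QCoh.Hom.nonempty_coker_iso _ (formHom (Q * H.map (C : ℂ → MvPolynomial (Fin 2) ℂ)) fun j l => ?_) (key _ (Or.inl rfl)).1
    (key _ (Or.inr rfl)).1 (key _ (Or.inl rfl)).2 (key _ (Or.inr rfl)).2
  refine Or.inr ⟨_, ?_, hQ' j l⟩
  rcases j with j | j
  · simp
  · simp
    ring

end ProjLine

/-! ### Linear functionals as binary forms, and secant points -/

open MvPolynomial

/-- The binary form of degree `n` cut out on the rational normal curve by a linear functional. -/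
def functionalForm (n : ℕ) : Module.Dual ℂ (Fin (n + 1) → ℂ) →ₗ[ℂ] MvPolynomial (Fin 2) ℂ where
  toFun ψ := ∑ i : Fin (n + 1), C (ψ (Pi.single i 1)) * (X 0 ^ (n - (i : ℕ)) * X 1 ^ (i : ℕ))
  map_add' ψ χ := by simp [add_mul, Finset.sum_add_distrib]
  map_smul' c ψ := by simp [smul_eq_C_mul, Finset.mul_sum, mul_assoc]

lemma eval_functionalForm {n : ℕ} (ψ : Module.Dual ℂ (Fin (n + 1) → ℂ)) (x : Fin 2 → ℂ) :
    eval x (functionalForm n ψ) = ψ (veronese n x) := by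
  have h : veronese n x = ∑ i, veronese n x i • (Pi.single i 1 : Fin (n + 1) → ℂ) :=
    pi_eq_sum_univ' _
  conv_rhs => rw [h]
  simp only [functionalForm, LinearMap.coe_mk, AddHom.coe_mk, map_sum, map_mul, map_pow, eval_C,
    eval_X, map_smul, smul_eq_mul, veronese]
  exact Finset.sum_congr rfl fun i _ => mul_comm _ _

lemma functionalForm_isHomogeneous {n : ℕ} (ψ : Module.Dual ℂ (Fin (n + 1) → ℂ)) :
    (functionalForm n ψ).IsHomogeneous n := by
  refine IsHomogeneous.sum _ _ _ fun i _ => ?_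
  have h := (isHomogeneous_C (Fin 2) (ψ (Pi.single i 1))).mul
    ((isHomogeneous_X_pow (R := ℂ) (0 : Fin 2) (n - (i : ℕ))).mul
      (isHomogeneous_X_pow (R := ℂ) (1 : Fin 2) (i : ℕ)))
  have e : 0 + (n - (i : ℕ) + (i : ℕ)) = n := by omega
  rwa [e] at h

/-- Every binary form of degree n is a hyperplane section of the rational normal curve, which
provides functionals for the multiples of g. -/
lemma exists_functionalForm_eq {n : ℕ} {P : MvPolynomial (Fin 2) ℂ} (hP : P.IsHomogeneous n) :
    ∃ ψ, functionalForm n ψ = P := by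
  refine ProjLine.IsHomogeneous.binary_induction (r := 0) (d := n)
    (p := fun P => ∃ ψ, functionalForm n ψ = P) ⟨0, map_zero _⟩ ?_ ?_ (by rwa [zero_add])
  · rintro _ _ ⟨ψ, rfl⟩ ⟨χ, rfl⟩
    exact ⟨ψ + χ, map_add _ _ _⟩
  · intro P i hP hi
    obtain ⟨c, rfl⟩ : ∃ c, P = C c :=
      ⟨_, totalDegree_eq_zero_iff_eq_C.1 ((totalDegree_zero_iff_isHomogeneous _).2 hP)⟩
    refine ⟨c • LinearMap.proj (⟨i, by omega⟩ : Fin (n + 1)), ?_⟩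
    rw [map_smul, smul_eq_C_mul]
    congr 1
    simp only [functionalForm, LinearMap.coe_mk, AddHom.coe_mk]
    rw [Finset.sum_eq_single (⟨i, by omega⟩ : Fin (n + 1))]
    · simp
    · intro j _ hj
      simp [Pi.single_eq_of_ne' hj]
    · simp

lemma veronese_smul (n : ℕ) (c : ℂ) (x : Fin 2 → ℂ) :
    veronese n (c • x) = c ^ n • veronese n x := by
  ext i
  have : c ^ n = c ^ (n - (i : ℕ)) * c ^ (i : ℕ) := by rw [← pow_add]; congr 1; omega
  simp only [veronese, Pi.smul_apply, smul_eq_mul, this]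
  ring

/-- The linear form that vanishes at the point `x` of the projective line. -/
def pointForm (x : Fin 2 → ℂ) : MvPolynomial (Fin 2) ℂ := C (x 1) * X 0 - C (x 0) * X 1

lemma eval_pointForm (x y : Fin 2 → ℂ) : eval y (pointForm x) = x 1 * y 0 - x 0 * y 1 := by
  simp [pointForm]

lemma pointForm_isHomogeneous (x : Fin 2 → ℂ) : (pointForm x).IsHomogeneous 1 := by
  have h := fun (a : ℂ) (i : Fin 2) => (isHomogeneous_C (Fin 2) a).mul (isHomogeneous_X ℂ i)
  exact (h (x 1) 0).sub (h (x 0) 1)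

lemma exists_smul_of_eval_pointForm {x y : Fin 2 → ℂ} (hx : x ≠ 0)
    (h : eval y (pointForm x) = 0) : ∃ c : ℂ, y = c • x := by
  rw [eval_pointForm] at h
  by_cases h0 : x 0 = 0
  · have h1 : x 1 ≠ 0 := fun h1 => hx (by ext i; fin_cases i; exacts [h0, h1])
    refine ⟨y 1 / x 1, ?_⟩
    ext i
    fin_cases i
    · simpa [h0, h1] using h
    · simp [h1]
  · refine ⟨y 0 / x 0, ?_⟩
    ext i
    fin_cases i
    · simp [h0]
    · simp only [Fin.mk_one, Pi.smul_apply, smul_eq_mul]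
      field_simp
      linear_combination -h

/-- At a simple zero of `g` where `h` does not vanish, the Wronskian of `g` and `h` does not vanish. -/
lemma eval_wronskian_ne_zero {n : ℕ} (hn : n ≠ 0) {x : Fin 2 → ℂ} {c : ℂ}
    {r h : MvPolynomial (Fin 2) ℂ} (hh : h.IsHomogeneous n) (hr : eval (c • x) r ≠ 0)
    (hx : eval (c • x) h ≠ 0) :
    eval (c • x) (pderiv 0 (pointForm x * r) * pderiv 1 h - pderiv 1 (pointForm x * r) * pderiv 0 h)
      ≠ 0 := by
  have h01 : pderiv (0 : Fin 2) (X 1 : MvPolynomial (Fin 2) ℂ) = 0 := pderiv_X_of_ne (by decide)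
  have h10 : pderiv (1 : Fin 2) (X 0 : MvPolynomial (Fin 2) ℂ) = 0 := pderiv_X_of_ne (by decide)
  have hl : eval (c • x) (pointForm x) = 0 := by
    rw [eval_pointForm]
    simp only [Pi.smul_apply, smul_eq_mul]
    ring
  have hE := congrArg (eval (c • x)) (ProjLine.euler_two hh)
  simp only [map_add, map_mul, eval_X, map_natCast, Pi.smul_apply, smul_eq_mul] at hE
  intro hW
  have d0 : pderiv 0 (pointForm x) = C (x 1) := by simp [pointForm, h01]
  have d1 : pderiv 1 (pointForm x) = -C (x 0) := by simp [pointForm, h10]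
  simp only [pderiv_mul, d0, d1, map_sub, map_mul, map_add, hl, map_neg, eval_C] at hW
  -- At this zero of the linear factor the gradient of the product is r (x 1, -x 0). So c times the
  -- Wronskian is r times the Euler expression of h, that is, r n h.
  have : eval (c • x) r * (n * eval (c • x) h) = 0 := by
    rw [← hE]
    linear_combination c * hW
  simp [hr, hx, hn] at this

lemma linearIndependent_monomials (m : ℕ) (c : Fin (m + 1) → ℂ)
    (h : ∑ i, C (c i) * (X 0 ^ (m - i : ℕ) * X 1 ^ (i : ℕ) : MvPolynomial (Fin 2) ℂ) = 0) :
    c = 0 := by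
  have h1 := congrArg ProjLine.dehom₀ h
  simp only [map_sum, map_mul, map_pow, map_zero, ProjLine.dehom₀, aeval_X, algHom_C,
    Matrix.cons_val_zero, Matrix.cons_val_one, one_pow, one_mul] at h1
  ext i
  have h2 := congrArg (fun p : ℂ[X] => p.coeff i) h1
  simp only [Polynomial.finsetSum_coeff, Polynomial.algebraMap_apply, Algebra.algebraMap_self,
    RingHom.id_apply, Polynomial.coeff_C_mul, Polynomial.coeff_X_pow, Polynomial.coeff_zero] at h2
  rw [Finset.sum_eq_single i] at h2
  · simpa using h2
  · intro j _ hj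
    have : (i : ℕ) ≠ j := fun h => hj (Fin.ext h.symm)
    simp [this]
  · simp

/-- A matrix with linearly independent rows and as many columns as rows is invertible. -/
lemma exists_inverse_of_vecMul {ι κ : Type*} [Fintype ι] [Fintype κ] [DecidableEq ι] [DecidableEq κ]
    (ε : ι ≃ κ) (H : Matrix ι κ ℂ) (hH : ∀ c, Matrix.vecMul c H = 0 → c = 0) :
    ∃ H' : Matrix κ ι ℂ, H * H' = 1 ∧ H' * H = 1 := by
  have hu : IsUnit (H.submatrix id ε) := by
    rw [← Matrix.vecMul_injective_iff_isUnit]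
    intro c d hcd
    rw [← sub_eq_zero]
    refine hH _ (funext fun j => ?_)
    have := congrFun hcd (ε.symm j)
    rw [Matrix.sub_vecMul, Pi.sub_apply, Pi.zero_apply, sub_eq_zero]
    simpa [Matrix.vecMul, dotProduct] using this
  obtain ⟨G, h1, h2⟩ := isUnit_iff_exists.1 hu
  refine ⟨G.submatrix ε.symm id, ?_, ?_⟩
  · rw [← h1]
    ext i j
    simp only [Matrix.mul_apply, Matrix.submatrix_apply, id]
    simp [← Equiv.sum_comp ε]
  · ext i j
    have := congrFun (congrFun h2 (ε.symm i)) (ε.symm j)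
    simp only [Matrix.mul_apply, Matrix.submatrix_apply, id, Equiv.apply_symm_apply,
      Matrix.one_apply, EmbeddingLike.apply_eq_iff_eq] at this ⊢
    exact this

/-- The two generators of the linear system of a projection from a hyperplane `L` of a secant space:
the form `g` of the secant points, and a form `h` that does not vanish there. -/
lemma exists_forms_of_secant {n k : ℕ} (hn : n ≠ 0)
    {L M : Submodule ℂ (Fin (n + 1) → ℂ)} (hL : Module.finrank ℂ L = k)
    (hLC : ∀ p ∈ rationalNormalCurve n, ¬ p.submodule ≤ L)
    (hM : IsSecantSpace n (k + 1) M) (hLM : L ≤ M) :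
    ∃ (g : MvPolynomial (Fin 2) ℂ) (ψ : Module.Dual ℂ (Fin (n + 1) → ℂ)) (x : Fin 2 → ℂ),
      g.IsHomogeneous (k + 1) ∧ g ≠ 0 ∧ eval x g = 0 ∧ ψ (veronese n x) ≠ 0 ∧
      L ≤ LinearMap.ker ψ ∧
      (∀ χ : Module.Dual ℂ (Fin (n + 1) → ℂ), g ∣ functionalForm n χ → L ≤ LinearMap.ker χ) ∧
      ∀ y : Fin 2 → ℂ, y ≠ 0 → eval y g = 0 →
        eval y (pderiv 0 g * pderiv 1 (functionalForm n ψ) -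
          pderiv 1 g * pderiv 0 (functionalForm n ψ)) ≠ 0 := by
  classical
  obtain ⟨hMk, S, hSC, hS, hMS⟩ := hM
  have hpt : ∀ p ∈ S, ∃ x : Fin 2 → ℂ, x ≠ 0 ∧ p.submodule = Submodule.span ℂ {veronese n x} :=
    fun p hp => hSC hp
  choose! x hx0 hx using hpt
  have hxM : ∀ p ∈ S, veronese n (x p) ∈ M := fun p hp => by
    have h1 : veronese n (x p) ∈ p.submodule := by
      rw [hx p hp]; exact Submodule.mem_span_singleton_self _
    rw [hMS]
    exact (le_iSup₂_of_le (f := fun (p : ℙ ℂ (Fin (n + 1) → ℂ)) (_ : p ∈ S) => p.submodule)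
      p hp le_rfl) h1
  have hxL : ∀ p ∈ S, veronese n (x p) ∉ L := fun p hp h => hLC p ⟨x p, hx0 p hp, hx p hp⟩ (by
    rw [hx p hp, Submodule.span_singleton_le_iff_mem]
    exact h)
  have hne : ∀ p ∈ S, ∀ q ∈ S, q ≠ p → eval (x p) (pointForm (x q)) ≠ 0 := by
    intro p hp q hq hqp h
    obtain ⟨c, hc⟩ := exists_smul_of_eval_pointForm (hx0 q hq) h
    refine hqp (Projectivization.submodule_injective (Submodule.eq_of_le_of_finrank_eq ?_ ?_)).symm
    · rw [hx p hp, hx q hq, hc, veronese_smul, Submodule.span_singleton_le_iff_mem]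
      exact Submodule.smul_mem _ _ (Submodule.mem_span_singleton_self _)
    · rw [Projectivization.finrank_submodule, Projectivization.finrank_submodule]
  obtain ⟨p₀, hp₀⟩ : S.Nonempty := Finset.card_pos.1 (by omega)
  obtain ⟨ψ, hψ, hLψ⟩ := L.exists_le_ker_of_notMem (hxL p₀ hp₀)
  -- L has codimension one in M and `ψ` is nonzero on M; hence a secant point killed by `ψ` would
  -- lie in L.
  have hML : M ⊓ LinearMap.ker ψ = L := by
    symm
    refine Submodule.eq_of_le_of_finrank_le (le_inf hLM hLψ) ?_
    have hlt : M ⊓ LinearMap.ker ψ < M := lt_of_le_of_ne inf_le_left fun h => hψ (by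
      have := hxM p₀ hp₀
      rw [← h] at this
      exact this.2)
    have := Submodule.finrank_lt_finrank_of_lt hlt
    omega
  have hψx : ∀ p ∈ S, ψ (veronese n (x p)) ≠ 0 := fun p hp h => hxL p hp (by
    rw [← hML]
    exact ⟨hxM p hp, h⟩)
  refine ⟨∏ p ∈ S, pointForm (x p), ψ, x p₀, ?_, ?_, ?_, hψ, hLψ, ?_, ?_⟩
  · have := IsHomogeneous.prod S (fun p => pointForm (x p)) (fun _ => 1)
      fun p _ => pointForm_isHomogeneous _
    simpa [hS] using this
  · rw [Finset.prod_ne_zero_iff]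
    intro p hp h
    refine hx0 p hp (funext fun i => ?_)
    have h0 := eval_pointForm (x p) ![1, 0]
    have h1 := eval_pointForm (x p) ![0, 1]
    rw [h] at h0 h1
    fin_cases i
    · simpa using h1
    · simpa using h0.symm
  · rw [map_prod]
    refine Finset.prod_eq_zero hp₀ ?_
    rw [eval_pointForm]
    ring
  · intro χ hχ
    -- A functional whose form is divisible by g kills every secant point, hence their span M.
    refine hLM.trans ?_
    rw [hMS]
    refine iSup₂_le fun p hp => ?_
    rw [hx p hp, Submodule.span_singleton_le_iff_mem, LinearMap.mem_ker, ← eval_functionalForm]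
    obtain ⟨f, hf⟩ := hχ
    rw [hf, map_mul, map_prod, Finset.prod_eq_zero hp, zero_mul]
    rw [eval_pointForm]
    ring
  · intro y hy hgy
    rw [map_prod, Finset.prod_eq_zero_iff] at hgy
    obtain ⟨p, hp, hpy⟩ := hgy
    obtain ⟨c, rfl⟩ := exists_smul_of_eval_pointForm (hx0 p hp) hpy
    have hc : c ≠ 0 := fun h => hy (by rw [h, zero_smul])
    rw [← Finset.mul_prod_erase S _ hp]
    refine eval_wronskian_ne_zero hn (functionalForm_isHomogeneous ψ) ?_ ?_
    · rw [map_prod, Finset.prod_ne_zero_iff]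
      intro q hq h
      refine hne p hp q (Finset.mem_of_mem_erase hq) (Finset.ne_of_mem_erase hq) ?_
      rw [eval_pointForm] at h ⊢
      simp only [Pi.smul_apply, smul_eq_mul] at h
      refine (mul_eq_zero.1 (?_ : c * _ = 0)).resolve_left hc
      linear_combination h
    · rw [eval_functionalForm, veronese_smul, map_smul]
      exact mul_ne_zero (pow_ne_zero _ hc) (hψx p hp)

/-! ### Change of coordinates on the target of the projection -/

theorem mainTheorem1 (n k : ℕ) (hk : 1 ≤ k) (hkn : k + 2 ≤ n)
    (L : Submodule ℂ (Fin (n + 1) → ℂ)) (hL : Module.finrank ℂ L = k)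
    (hLC : ∀ p ∈ rationalNormalCurve n, ¬ p.submodule ≤ L)
    (hsec : ∃ M : Submodule ℂ (Fin (n + 1) → ℂ), IsSecantSpace n (k + 1) M ∧ L ≤ M)
    (π : (Fin (n + 1) → ℂ) →ₗ[ℂ] (Fin (n - k + 1) → ℂ))
    (hπ : Function.Surjective π) (hπL : LinearMap.ker π = L) :
    Nonempty ((ProjLine.normalSheaf (projectedCurve π) (projectedCurve_isHomogeneous π)).Iso
      (ProjLine.sumO (Sum.elim (fun _ : Fin (n - k - 2) => (n : ℤ) + 2)
        (fun _ : Fin 1 => (n : ℤ) + 2 + 2 * (k : ℤ))))) := by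
  obtain ⟨e, rfl⟩ : ∃ e, n = k + e + 2 := ⟨n - k - 2, by omega⟩
  revert π
  -- The truncated subtraction occurs in the type of `π`; naming it allows its replacement by e + 2.
  generalize hm : k + e + 2 - k = m
  obtain rfl : m = e + 2 := by omega
  intro π hπ hπL
  change Nonempty (ProjLine.QCoh.Iso _ (ProjLine.sumO (Sum.elim (fun _ : Fin e => _) _)))
  obtain ⟨M, hM, hLM⟩ := hsec
  obtain ⟨g, ψ, x, hg, hg0, hxg, hxψ, hLψ, hdvd, hW⟩ :=
    exists_forms_of_secant (by omega) hL hLC hM hLM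
  have hmul : ∀ i : Fin (e + 2), ∃ χ, functionalForm (k + e + 2) χ =
      g * (X 0 ^ (e + 1 - i : ℕ) * X 1 ^ (i : ℕ)) := fun i => exists_functionalForm_eq (by
    convert hg.mul ((isHomogeneous_X_pow (R := ℂ) (0 : Fin 2) (e + 1 - i : ℕ)).mul
      (isHomogeneous_X_pow (R := ℂ) (1 : Fin 2) (i : ℕ))) using 1
    omega)
  choose χ hχ using hmul
  -- A functional vanishing on the kernel L of `π` factors through `π`, so its form is a combination
  -- of the coordinates of the projected curve.
  have hfactor : ∀ ω : Module.Dual ℂ (Fin (k + e + 2 + 1) → ℂ), L ≤ LinearMap.ker ω →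
      ∃ η : Module.Dual ℂ (Fin (e + 2 + 1) → ℂ), η ∘ₗ π = ω := by
    intro ω hω
    have : ω ∈ LinearMap.range π.dualMap := by
      rw [LinearMap.range_dualMap_eq_dualAnnihilator_ker, hπL, Submodule.mem_dualAnnihilator]
      exact hω
    exact this
  have hfactor' : ∀ l : Fin (e + 2) ⊕ Fin 1, ∃ η : Module.Dual ℂ (Fin (e + 2 + 1) → ℂ),
      η ∘ₗ π = Sum.elim χ (fun _ => ψ) l := by
    rintro (l | l)
    · exact hfactor _ (hdvd _ ⟨_, hχ l⟩)
    · exact hfactor _ hLψ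
  choose η hη using hfactor'
  let H : Matrix (Fin (e + 2) ⊕ Fin 1) (Fin (e + 2 + 1)) ℂ := fun l j => η l (Pi.single j 1)
  have hHη : ∀ (l) (v : Fin (e + 2 + 1) → ℂ), η l v = ∑ j, H l j * v j := by
    intro l v
    conv_lhs => rw [pi_eq_sum_univ' v]
    rw [map_sum]
    exact Finset.sum_congr rfl fun j _ => by rw [map_smul, smul_eq_mul, mul_comm]
  have hform : ∀ l, functionalForm (k + e + 2) (Sum.elim χ (fun _ => ψ) l) =
      ∑ j, C (H l j) * projectedCurve π j := by
    intro l
    have h1 : Sum.elim χ (fun _ => ψ) l = ∑ j, H l j • (LinearMap.proj j ∘ₗ π) := by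
      rw [← hη]
      refine LinearMap.ext fun v => ?_
      simp [hHη]
    rw [h1, map_sum]
    refine Finset.sum_congr rfl fun j _ => ?_
    rw [map_smul, smul_eq_C_mul]
    rfl
  -- A relation among the rows gives one among the forms g mᵢ and h. Evaluating at a zero of g where
  -- h ≠ 0 removes h; cancelling g leaves a relation among monomials.
  obtain ⟨H', h1, h2⟩ := exists_inverse_of_vecMul finSumFinEquiv H (by
    intro c hc
    have hsum : ∑ l, C (c l) * functionalForm (k + e + 2) (Sum.elim χ (fun _ => ψ) l) = 0 := by
      simp only [hform, Finset.mul_sum]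
      rw [Finset.sum_comm]
      refine Finset.sum_eq_zero fun j _ => ?_
      have := congrFun hc j
      rw [Matrix.vecMul, dotProduct, Pi.zero_apply] at this
      simp only [← mul_assoc, ← C_mul, ← Finset.sum_mul, ← map_sum, this, map_zero, zero_mul]
    rw [Fintype.sum_sum_type] at hsum
    simp only [Sum.elim_inl, Sum.elim_inr, hχ, Fin.sum_univ_one, mul_left_comm _ g,
      ← Finset.mul_sum] at hsum
    have hr : c (Sum.inr 0) = 0 := by
      have := congrArg (eval x) hsum
      simpa [hxg, eval_functionalForm, hxψ] using this
    rw [hr, map_zero, zero_mul, add_zero, mul_eq_zero] at hsum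
    have hl := linearIndependent_monomials (e + 1) _ (hsum.resolve_left hg0)
    ext (l | l)
    · exact congrFun hl l
    · rw [Subsingleton.elim l 0]
      exact hr)
  exact ProjLine.nonempty_normalSheaf_iso hg (functionalForm_isHomogeneous ψ) hW (projectedCurve π)
    (projectedCurve_isHomogeneous π) H H' h1 h2 (fun i => (hχ i).symm.trans (hform (Sum.inl i)))
    (hform (Sum.inr 0))
end
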